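/- Let $N\ge 1$, let $\Omega\subset\mathbb R^N$ be a bounded domain, $T>0$, $Q_T=\Omega\times(0,T)$, $\Sigma_T=\partial\Omega\times(0,T)$. Let $c\in C^1(\overline\Omega;\mathcal M_N(\mathbb R))$ satisfy $(c(x)\xi,\xi)\ge c_0|\xi|^2$ for all $x\in\overline\Omega$, $\xi\in\mathbb R^N$, with some $c_0>0$, let $d\in L^\infty(Q_T)$, and put $$Ly=y_t-\nabla\cdot(c\nabla y)+d\,y,\qquad L^\star\varphi=-\varphi_t-\nabla\cdot(c\nabla\varphi)+d\,\varphi .$$ For $\rho_\star>0$ let $\mathcal R$ be the set of functions $w\in C(Q_T)$ with $w\ge\rho_\star$ in $Q_T$ and $w\in L^\infty(\Omega\times(\delta,T))$ for every $\delta>0$. Let $\rho_0\in\mathcal R$, $\rho\in\mathcal R\cap L^\infty(Q_T)$, $\eta>0$, and let $q_T=\omega\times(0,T)$ with $\omega\subset\Omega$ open and non-empty. Let $\mathcal Y$ be the (Hausdorff) completion of $\{y\in C^2(\overline{Q_T}): y=0\text{ on }\Sigma_T\}$ for the scalar product $(y,\bar y)=\iint_{q_T}\rho_0^{-2}y\bar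 y+\eta\iint_{Q_T}\rho^{-2}Ly\,L\bar y$; the maps $y\mapsto\rho_0^{-1}y\in L^2(q_T)$ and $y\mapsto\rho^{-1}Ly\in L^2(Q_T)$ are extended to $\mathcal Y$ by continuity. Let $$\Lambda=\{\lambda:\ \rho^{-1}\lambda\in C^0([0,T];L^2(\Omega)),\ \rho_0L^\star(\rho^{-1}\lambda)\in L^2(Q_T),\ \rho^{-1}\lambda=0\text{ on }\Sigma_T,\ (\rho^{-1}\lambda)(\cdot,T)=0\}$$ with scalar product $\iint_{Q_T}\big(\rho^{-2}\lambda\bar\lambda+\rho_0^2L^\star(\rho^{-1}\lambda)L^\star(\rho^{-1}\bar\lambda)\big)$, where $L^\star$ acts in the sense of distributions and the condition on $\Sigma_T$ means $\rho^{-1}\lambda\in L^2(0,T;H^1_0(\Omega))$. For $\alpha\in(0,1)$, $r>0$ and $y_{obs}\in L^2(q_T)$ consider the problem: find $(y,\lambda)\in\mathcal Y\times\Lambda$ with $$a_{r,\alpha}(y,\bar y)+b_\alpha(\bar y,\lambda)=l_{1,\alpha}(\bar y)\ \ \forall\bar y\in\mathcal Y,\qquad b_\alpha(y,\bar\lambda)-c_\alpha(\lambda,\bar\lambda)=l_{2,\alpha}(\bar\lambda)\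 \ \forall\bar\lambda\in\Lambda,\tag{M}$$ where $$a_{r,\alpha}(y,\bar y)=(1-\alpha)\iint_{q_T}\rho_0^{-2}y\bar y+r\iint_{Q_T}\rho^{-2}Ly\,L\bar y,\qquad b_\alpha(y,\lambda)=\iint_{Q_T}\rho^{-1}Ly\,\lambda-\alpha\iint_{q_T}L^\star(\rho^{-1}\lambda)\,y,$$ $$c_\alpha(\lambda,\bar\lambda)=\alpha\iint_{Q_T}\rho_0^2L^\star(\rho^{-1}\lambda)L^\star(\rho^{-1}\bar\lambda),\quad l_{1,\alpha}(y)=(1-\alpha)\iint_{q_T}\rho_0^{-2}y_{obs}\,y,\quad l_{2,\alpha}(\lambda)=-\alpha\iint_{q_T}y_{obs}\,L^\star(\rho^{-1}\lambda).$$ Then the following hold. 1. There is a constant $C>0$, depending only on $\Omega,T,c,d$ (not on $\omega,\rho_\star,\rho_0,\rho,\eta$), with $\|\rho^{-1}\lambda\|_{L^2(Q_T)}\le C\|L^\star(\rho^{-1}\lambda)\|_{L^2(Q_T)}$ for all $\lambda\in\Lambda$. 2. For all $\alpha\in(0,1)$ and $r>0$ the mixed problem is well posed: for arbitrary continuous linear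 forms on $\mathcal Y$ and $\Lambda$ in place of $l_{1,\alpha},l_{2,\alpha}$ there is exactly one solution, and it depends linearly and continuously on these forms. In particular, for every $y_{obs}\in L^2(q_T)$ problem (M) has exactly one solution $(y,\lambda)\in\mathcal Y\times\Lambda$. 3. Let $C_{\Omega,T}\ge0$ be any constant for which the inequality in 1 holds on $\Lambda$, and put $$\theta_1=\min\Big(1-\alpha,\frac r\eta\Big),\qquad \theta_2=\frac{\alpha\rho_\star^2}{\rho_\star^2+C_{\Omega,T}^2}.$$ Then $a_{r,\alpha}(y,y)\ge\theta_1\|y\|_{\mathcal Y}^2$ for all $y\in\mathcal Y$ and $c_\alpha(\lambda,\lambda)\ge\theta_2\|\lambda\|_\Lambda^2$ for all $\lambda\in\Lambda$, and the solution $(y,\lambda)$ of (M) satisfies $$\theta_1\|y\|_{\mathcal Y}^2+\theta_2\|\lambda\|_\Lambda^2\le\Big(\frac{(1-\alpha)^2}{\theta_1}+\frac{\alpha^2}{\theta_2}\Big)\|\rho_0^{-1}y_{obs}\|_{L^2(q_T)}^2 .$$ -/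

import Mathlib

open MeasureTheory Set Filter Topology
open scoped ENNReal

noncomputable section

namespace ParabolicInverse

/-- Space-time points `(x, t)` with `x ∈ ℝ^N`. -/
abbrev Pt (N : ℕ) : Type := EuclideanSpace ℝ (Fin N) × ℝ

/-- Time derivative `∂_t y`. -/
def dt {N : ℕ} (y : Pt N → ℝ) (p : Pt N) : ℝ := fderiv ℝ y p (0, 1)

/-- Space derivative `∂_{x_i} y`. -/
def dx {N : ℕ} (i : Fin N) (y : Pt N → ℝ) (p : Pt N) : ℝ :=
  fderiv ℝ y p (EuclideanSpace.single i 1, 0)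

/-- The data of the parabolic operator: a bounded domain `Ω ⊂ ℝ^N`, a time `T > 0`, a uniformly
elliptic matrix `c ∈ C¹(closure Ω)` (not assumed symmetric) and a potential `d ∈ L^∞(Q_T)`. -/
structure Problem (N : ℕ) where
  Ω : Set (EuclideanSpace ℝ (Fin N))
  isOpen_Ω : IsOpen Ω
  isConnected_Ω : IsConnected Ω
  isBounded_Ω : Bornology.IsBounded Ω
  T : ℝ
  T_pos : 0 < T
  c : EuclideanSpace ℝ (Fin N) → Matrix (Fin N) (Fin N) ℝ
  contDiffOn_c : ∀ i j, ContDiffOn ℝ 1 (fun x => c x i j) (closure Ω)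
  c₀ : ℝ
  c₀_pos : 0 < c₀
  elliptic : ∀ x ∈ closure Ω, ∀ ξ : EuclideanSpace ℝ (Fin N),
    c₀ * ‖ξ‖ ^ 2 ≤ ∑ i, ∑ j, c x i j * ξ j * ξ i
  d : Pt N → ℝ
  memLp_d : MemLp d ∞ (volume.restrict (Ω ×ˢ Ioo 0 T))

variable {N : ℕ}

namespace Problem

variable (P : Problem N)

/-- The cylinder `Q_T = Ω × (0, T)`. -/
def QT : Set (Pt N) := P.Ω ×ˢ Ioo 0 P.T

/-- The lateral boundary `Σ_T = ∂Ω × (0, T)`. -/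
def lateral : Set (Pt N) := frontier P.Ω ×ˢ Ioo 0 P.T

/-- Lebesgue measure on `Ω`. -/
abbrev μΩ : Measure (EuclideanSpace ℝ (Fin N)) := volume.restrict P.Ω

/-- Lebesgue measure on `Q_T`. -/
abbrev μQ : Measure (Pt N) := volume.restrict P.QT

/-- `L y = y_t - ∇ · (c ∇ y) + d y`. -/
def L (y : Pt N → ℝ) (p : Pt N) : ℝ :=
  dt y p - ∑ i, dx i (fun q => ∑ j, P.c q.1 i j * dx j y q) p + P.d p * y p

lemma isOpen_QT : IsOpen P.QT := P.isOpen_Ω.prod isOpen_Ioo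

lemma isBounded_QT : Bornology.IsBounded P.QT :=
  P.isBounded_Ω.prod (Metric.isBounded_Ioo 0 P.T)

instance : IsFiniteMeasure P.μQ :=
  ⟨by
    rw [Measure.restrict_apply_univ]
    exact P.isBounded_QT.measure_lt_top⟩

end Problem

/-- The class `R` of weights: continuous on `Q_T`, bounded below there by `ρstar`, and essentially
bounded on `Ω × (δ, T)` for every `δ > 0`. -/
structure IsWeight (P : Problem N) (ρstar : ℝ) (w : Pt N → ℝ) : Prop where
  continuousOn : ContinuousOn w P.QT
  lower : ∀ p ∈ P.QT, ρstar ≤ w p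
  bounded : ∀ δ > 0, MemLp w ∞ (volume.restrict (P.Ω ×ˢ Ioo δ P.T))

/-- The remaining data: the observation set `ω`, the weights `ρ₀ ∈ R` and `ρ ∈ R ∩ L^∞(Q_T)`, and
the parameter `η > 0` of the norm of the state space. -/
structure Setting (P : Problem N) where
  ω : Set (EuclideanSpace ℝ (Fin N))
  isOpen_ω : IsOpen ω
  nonempty_ω : ω.Nonempty
  ω_subset : ω ⊆ P.Ω
  ρstar : ℝ
  ρstar_pos : 0 < ρstar
  ρ₀ : Pt N → ℝ
  isWeight_ρ₀ : IsWeight P ρstar ρ₀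
  ρ : Pt N → ℝ
  isWeight_ρ : IsWeight P ρstar ρ
  memLp_ρ : MemLp ρ ∞ P.μQ
  η : ℝ
  η_pos : 0 < η

/-! ### Auxiliary facts on derivatives -/

lemma exists_bound_iteratedFDeriv {E F : Type*} [NormedAddCommGroup E] [NormedSpace ℝ E]
    [NormedAddCommGroup F] [NormedSpace ℝ F] {f : E → F} {U : Set E} (hU : IsOpen U)
    (hK : IsCompact (closure U)) {n : ℕ} (hf : ContDiffOn ℝ n f (closure U)) {k : ℕ}
    (hk : k ≤ n) : ∃ M : ℝ, ∀ x ∈ U, ‖iteratedFDeriv ℝ k f x‖ ≤ M := by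
  have key : ∃ M : ℝ, ∀ x ∈ closure U ∩ U, ‖iteratedFDeriv ℝ k f x‖ ≤ M := by
    refine hK.induction_on (p := fun s => ∃ M : ℝ, ∀ x ∈ s ∩ U, ‖iteratedFDeriv ℝ k f x‖ ≤ M)
      ⟨0, by simp⟩ ?_ ?_ ?_
    · rintro s t hst ⟨M, hM⟩
      exact ⟨M, fun x hx => hM x ⟨hst hx.1, hx.2⟩⟩
    · rintro s t ⟨M, hM⟩ ⟨M', hM'⟩
      refine ⟨max M M', ?_⟩
      rintro x ⟨hx | hx, hxU⟩
      · exact (hM x ⟨hx, hxU⟩).trans (le_max_left _ _)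
      · exact (hM' x ⟨hx, hxU⟩).trans (le_max_right _ _)
    · intro x hx
      obtain ⟨u, hu, p, hp⟩ := contDiffWithinAt_nat.1 (hf x hx)
      rw [insert_eq_of_mem hx] at hu
      have hxu : x ∈ u := mem_of_mem_nhdsWithin hx hu
      have hc : ContinuousWithinAt (fun z => ‖p z k‖) u x :=
        ((hp.cont k (by exact_mod_cast hk)) x hxu).norm
      have hb : {z | ‖p z k‖ < ‖p x k‖ + 1} ∈ 𝓝[closure U] x :=
        nhdsWithin_le_of_mem hu (hc (Iio_mem_nhds (lt_add_one _)))
      obtain ⟨V, hVo, hxV, hV⟩ := mem_nhdsWithin.1 (inter_mem hu hb)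
      refine ⟨V ∩ closure U, mem_nhdsWithin.2 ⟨V, hVo, hxV, subset_rfl⟩, ‖p x k‖ + 1, ?_⟩
      rintro z ⟨⟨hzV, -⟩, hzU⟩
      have hsub : V ∩ U ⊆ u := fun w hw => (hV ⟨hw.1, subset_closure hw.2⟩).1
      have ho : IsOpen (V ∩ U) := hVo.inter hU
      have e := (hp.mono hsub).eq_iteratedFDerivWithin_of_uniqueDiffOn
        (m := k) (by exact_mod_cast hk) ho.uniqueDiffOn ⟨hzV, hzU⟩
      rw [iteratedFDerivWithin_of_isOpen k ho ⟨hzV, hzU⟩] at e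
      rw [← e]
      exact le_of_lt (hV ⟨hzV, subset_closure hzU⟩).2
  obtain ⟨M, hM⟩ := key
  exact ⟨M, fun x hx => hM x ⟨subset_closure hx, hx⟩⟩

namespace Problem

variable (P : Problem N)

lemma memLp_top_of_continuousOn {f : Pt N → ℝ} (hf : ContinuousOn f P.QT)
    {M : ℝ} (hM : ∀ p ∈ P.QT, |f p| ≤ M) : MemLp f ∞ P.μQ :=
  memLp_top_of_bound (hf.aestronglyMeasurable P.isOpen_QT.measurableSet) M
    (ae_restrict_of_forall_mem P.isOpen_QT.measurableSet hM)

/-- Functions in `C²(closure Q_T)` that vanish on `Σ_T`. -/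
structure IsRegular (y : Pt N → ℝ) : Prop where
  contDiffOn : ContDiffOn ℝ 2 y (closure P.QT)
  eq_zero : ∀ p ∈ P.lateral, y p = 0

variable {P}

lemma contDiffAt_of_contDiffOn {y : Pt N → ℝ} (hy : ContDiffOn ℝ 2 y (closure P.QT)) {p : Pt N}
    (hp : p ∈ P.QT) : ContDiffAt ℝ 2 y p :=
  (hy.mono subset_closure).contDiffAt (P.isOpen_QT.mem_nhds hp)

lemma contDiffAt_c (i j : Fin N) {p : Pt N} (hp : p ∈ P.QT) :
    ContDiffAt ℝ 1 (fun x => P.c x i j) p.1 :=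
  ((P.contDiffOn_c i j).mono subset_closure).contDiffAt (P.isOpen_Ω.mem_nhds hp.1)

lemma fderiv_differentiableAt {y : Pt N → ℝ} (hy : ContDiffOn ℝ 2 y (closure P.QT)) {p : Pt N}
    (hp : p ∈ P.QT) : DifferentiableAt ℝ (fderiv ℝ y) p :=
  ((contDiffAt_of_contDiffOn hy hp).fderiv_right (m := 1) (by norm_num)).differentiableAt
    one_ne_zero

lemma dx_differentiableAt {y : Pt N → ℝ} (hy : ContDiffOn ℝ 2 y (closure P.QT)) (j : Fin N)
    {p : Pt N} (hp : p ∈ P.QT) : DifferentiableAt ℝ (dx j y) p :=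
  (fderiv_differentiableAt hy hp).clm_apply (differentiableAt_const _)

lemma c_differentiableAt (i j : Fin N) {p : Pt N} (hp : p ∈ P.QT) :
    DifferentiableAt ℝ (fun q : Pt N => P.c q.1 i j) p :=
  DifferentiableAt.comp (f := Prod.fst) p ((contDiffAt_c i j hp).differentiableAt one_ne_zero)
    differentiableAt_fst

lemma dx_flux {y : Pt N → ℝ} (hy : ContDiffOn ℝ 2 y (closure P.QT)) (i : Fin N)
    {p : Pt N} (hp : p ∈ P.QT) :
    dx i (fun q => ∑ j, P.c q.1 i j * dx j y q) p =
      ∑ j, (fderiv ℝ (fun x => P.c x i j) p.1 (EuclideanSpace.single i 1) * dx j y p +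
        P.c p.1 i j * fderiv ℝ (fderiv ℝ y) p (EuclideanSpace.single i 1, 0)
          (EuclideanSpace.single j 1, 0)) := by
  have h0 : fderiv ℝ (fun q : Pt N => ∑ j, P.c q.1 i j * dx j y q) p =
      ∑ j, fderiv ℝ (fun q : Pt N => P.c q.1 i j * dx j y q) p :=
    fderiv_fun_sum (A := fun j (q : Pt N) => P.c q.1 i j * dx j y q) fun j _ =>
      (c_differentiableAt i j hp).mul (dx_differentiableAt hy j hp)
  rw [dx, h0, sum_apply]
  refine Finset.sum_congr rfl fun j _ => ?_
  rw [fderiv_fun_mul (c_differentiableAt i j hp) (dx_differentiableAt hy j hp)]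
  have h1 : fderiv ℝ (fun q : Pt N => P.c q.1 i j) p =
      (fderiv ℝ (fun x => P.c x i j) p.1).comp (ContinuousLinearMap.fst ℝ _ _) := by
    have := fderiv_comp (f := (Prod.fst : Pt N → _)) p
      ((contDiffAt_c i j hp).differentiableAt one_ne_zero) differentiableAt_fst
    rw [fderiv_fst] at this
    exact this
  have h2 : fderiv ℝ (dx j y) p
      (EuclideanSpace.single i 1, 0) = fderiv ℝ (fderiv ℝ y) p (EuclideanSpace.single i 1, 0)
          (EuclideanSpace.single j 1, 0) := by
    unfold dx
    rw [fderiv_clm_apply (fderiv_differentiableAt hy hp) (differentiableAt_const _)]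
    simp
  simp only [add_apply, smul_apply, smul_eq_mul]
  rw [h1, h2]
  simp
  ring

lemma L_add {y z : Pt N → ℝ} (hy : ContDiffOn ℝ 2 y (closure P.QT))
    (hz : ContDiffOn ℝ 2 z (closure P.QT)) {p : Pt N} (hp : p ∈ P.QT) :
    P.L (y + z) p = P.L y p + P.L z p := by
  have dy := (contDiffAt_of_contDiffOn hy hp).differentiableAt two_ne_zero
  have dz := (contDiffAt_of_contDiffOn hz hp).differentiableAt two_ne_zero
  have e2 : fderiv ℝ (fderiv ℝ (y + z)) p =
      fderiv ℝ (fderiv ℝ y) p + fderiv ℝ (fderiv ℝ z) p := by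
    rw [← fderiv_add (fderiv_differentiableAt hy hp) (fderiv_differentiableAt hz hp)]
    refine Filter.EventuallyEq.fderiv_eq ?_
    filter_upwards [P.isOpen_QT.mem_nhds hp] with q hq
    exact fderiv_add ((contDiffAt_of_contDiffOn hy hq).differentiableAt two_ne_zero)
      ((contDiffAt_of_contDiffOn hz hq).differentiableAt two_ne_zero)
  have e1 := fderiv_add dy dz
  have e3 : ∀ i, _ := fun i => dx_flux (P := P) (y := y + z) (hy.add hz) i hp
  simp only [L, e3, dx_flux hy _ hp, dx_flux hz _ hp, e2]
  simp only [dt, dx, e1, add_apply, Pi.add_apply, mul_add, Finset.sum_add_distrib]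
  ring

lemma L_smul {y : Pt N → ℝ} (a : ℝ) (hy : ContDiffOn ℝ 2 y (closure P.QT)) {p : Pt N}
    (hp : p ∈ P.QT) : P.L (a • y) p = a * P.L y p := by
  have dy := (contDiffAt_of_contDiffOn hy hp).differentiableAt two_ne_zero
  have e2 : fderiv ℝ (fderiv ℝ (a • y)) p = a • fderiv ℝ (fderiv ℝ y) p := by
    rw [← fderiv_const_smul (fderiv_differentiableAt hy hp)]
    refine Filter.EventuallyEq.fderiv_eq ?_
    filter_upwards [P.isOpen_QT.mem_nhds hp] with q hq
    exact fderiv_const_smul ((contDiffAt_of_contDiffOn hy hq).differentiableAt two_ne_zero) a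
  have e1 := fderiv_const_smul dy a
  have hay : ContDiffOn ℝ 2 (a • y) (closure P.QT) := contDiffOn_const.smul hy
  simp only [L, dx_flux hay _ hp, dx_flux hy _ hp, e2]
  simp only [dt, dx, e1, smul_apply, Pi.smul_apply, smul_eq_mul, mul_add, mul_sub,
    Finset.sum_add_distrib, Finset.mul_sum]
  congr 1
  · congr 2 <;> refine Finset.sum_congr rfl fun i _ => Finset.sum_congr rfl fun j _ => ?_ <;> ring
  · ring

lemma memLp_top_self {y : Pt N → ℝ} (hy : ContDiffOn ℝ 2 y (closure P.QT)) :
    MemLp y ∞ P.μQ := by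
  obtain ⟨M, hM⟩ := P.isBounded_QT.isCompact_closure.exists_bound_of_continuousOn hy.continuousOn
  exact P.memLp_top_of_continuousOn (hy.continuousOn.mono subset_closure)
    fun p hp => hM p (subset_closure hp)

lemma memLp_top_fderiv {y : Pt N → ℝ} (hy : ContDiffOn ℝ 2 y (closure P.QT)) (v : Pt N) :
    MemLp (fun p => fderiv ℝ y p v) ∞ P.μQ := by
  obtain ⟨M, hM⟩ := exists_bound_iteratedFDeriv P.isOpen_QT P.isBounded_QT.isCompact_closure
    (n := 2) hy (k := 1) (by norm_num)
  refine P.memLp_top_of_continuousOn (M := M * ‖v‖) ?_ fun p hp => ?_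
  · exact ((hy.mono subset_closure).continuousOn_fderiv_of_isOpen P.isOpen_QT
      (by norm_num)).clm_apply continuousOn_const
  · have := hM p hp
    rw [norm_iteratedFDeriv_one] at this
    exact ((fderiv ℝ y p).le_opNorm v).trans (by gcongr)

lemma memLp_top_fderiv_fderiv {y : Pt N → ℝ} (hy : ContDiffOn ℝ 2 y (closure P.QT))
    (v w : Pt N) : MemLp (fun p => fderiv ℝ (fderiv ℝ y) p v w) ∞ P.μQ := by
  obtain ⟨M, hM⟩ := exists_bound_iteratedFDeriv P.isOpen_QT P.isBounded_QT.isCompact_closure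
    (n := 2) hy (k := 2) le_rfl
  refine P.memLp_top_of_continuousOn (M := M * ‖v‖ * ‖w‖) ?_ fun p hp => ?_
  · exact ((((hy.mono subset_closure).fderiv_of_isOpen (m := 1) P.isOpen_QT
      (by norm_num)).continuousOn_fderiv_of_isOpen P.isOpen_QT
      le_rfl).clm_apply continuousOn_const).clm_apply continuousOn_const
  · have := hM p hp
    rw [← norm_iteratedFDeriv_fderiv, norm_iteratedFDeriv_one] at this
    exact ((fderiv ℝ (fderiv ℝ y) p).le_opNorm₂ v w).trans (by gcongr)

lemma memLp_top_c (i j : Fin N) : MemLp (fun p : Pt N => P.c p.1 i j) ∞ P.μQ := by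
  obtain ⟨M, hM⟩ := P.isBounded_Ω.isCompact_closure.exists_bound_of_continuousOn
    (P.contDiffOn_c i j).continuousOn
  exact P.memLp_top_of_continuousOn ((P.contDiffOn_c i j).continuousOn.comp continuousOn_fst
    fun p hp => subset_closure hp.1) fun p hp => hM p.1 (subset_closure hp.1)

lemma memLp_top_fderiv_c (i j : Fin N) (v : EuclideanSpace ℝ (Fin N)) :
    MemLp (fun p : Pt N => fderiv ℝ (fun x => P.c x i j) p.1 v) ∞ P.μQ := by
  obtain ⟨M, hM⟩ := exists_bound_iteratedFDeriv P.isOpen_Ω P.isBounded_Ω.isCompact_closure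
    (n := 1) (P.contDiffOn_c i j) (k := 1) le_rfl
  refine P.memLp_top_of_continuousOn (M := M * ‖v‖) ?_ fun p hp => ?_
  · exact ((((P.contDiffOn_c i j).mono subset_closure).continuousOn_fderiv_of_isOpen P.isOpen_Ω
      le_rfl).comp continuousOn_fst fun p hp => hp.1).clm_apply continuousOn_const
  · have := hM p.1 hp.1
    rw [norm_iteratedFDeriv_one] at this
    exact ((fderiv ℝ (fun x => P.c x i j) p.1).le_opNorm v).trans (by gcongr)

lemma memLp_top_L {y : Pt N → ℝ} (hy : ContDiffOn ℝ 2 y (closure P.QT)) :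
    MemLp (P.L y) ∞ P.μQ := by
  have h : MemLp (fun p => dt y p - ∑ i, ∑ j,
      (fderiv ℝ (fun x => P.c x i j) p.1 (EuclideanSpace.single i 1) * dx j y p +
        P.c p.1 i j * fderiv ℝ (fderiv ℝ y) p (EuclideanSpace.single i 1, 0)
          (EuclideanSpace.single j 1, 0)) + P.d p * y p) ∞ P.μQ := by
    refine ((memLp_top_fderiv hy _).sub (memLp_finsetSum _ fun i _ =>
      memLp_finsetSum _ fun j _ => ?_)).add ((memLp_top_self hy).mul P.memLp_d)
    exact ((memLp_top_fderiv hy _).mul (memLp_top_fderiv_c i j _)).add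
      ((memLp_top_fderiv_fderiv hy _ _).mul (memLp_top_c i j))
  refine h.ae_eq ?_
  filter_upwards [ae_restrict_mem P.isOpen_QT.measurableSet] with p hp
  simp only [L, dx_flux hy _ hp]

end Problem

/-! ### The state space -/

lemma memLp_two_of_top {P : Problem N} {f : Pt N → ℝ} (hf : MemLp f ∞ P.μQ) :
    MemLp f 2 P.μQ := hf.mono_exponent le_top

lemma IsWeight.pos {P : Problem N} {r : ℝ} {w : Pt N → ℝ} (hw : IsWeight P r w) (hr : 0 < r)
    {p : Pt N} (hp : p ∈ P.QT) : 0 < w p := hr.trans_le (hw.lower p hp)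

lemma IsWeight.memLp_inv {P : Problem N} {r : ℝ} {w : Pt N → ℝ} (hw : IsWeight P r w)
    (hr : 0 < r) : MemLp (fun p => (w p)⁻¹) ∞ P.μQ := by
  refine P.memLp_top_of_continuousOn (M := r⁻¹)
    (hw.continuousOn.inv₀ fun p hp => (hw.pos hr hp).ne') fun p hp => ?_
  rw [abs_of_pos (inv_pos.2 (hw.pos hr hp))]
  exact inv_anti₀ hr (hw.lower p hp)

/-- The space `Y₀` of functions in `C²(closure Q_T)` vanishing on `Σ_T`. -/
def regularSubmodule (P : Problem N) : Submodule ℝ (Pt N → ℝ) where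
  carrier := {y | P.IsRegular y}
  add_mem' hy hz := ⟨hy.1.add hz.1, fun p hp => by simp [hy.2 p hp, hz.2 p hp]⟩
  zero_mem' := ⟨contDiffOn_const, fun _ _ => rfl⟩
  smul_mem' a y hy := ⟨contDiffOn_const.smul hy.1, fun p hp => by simp [hy.2 p hp]⟩

namespace Setting

variable {P : Problem N} (W : Setting P)

/-- The observation cylinder `q_T = ω × (0, T)`. -/
def qT : Set (Pt N) := W.ω ×ˢ Ioo 0 P.T

/-- Lebesgue measure on `q_T`. -/
abbrev μq : Measure (Pt N) := volume.restrict W.qT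

lemma qT_subset : W.qT ⊆ P.QT := prod_mono W.ω_subset subset_rfl

lemma μq_le : W.μq ≤ P.μQ := Measure.restrict_mono W.qT_subset le_rfl

/-- `Y₀`, to be normed by the scalar product of the setting `W`. -/
def Y₀ (_W : Setting P) : Type := regularSubmodule P

instance : AddCommGroup W.Y₀ := inferInstanceAs (AddCommGroup (regularSubmodule P))

instance : Module ℝ W.Y₀ := inferInstanceAs (Module ℝ (regularSubmodule P))

/-- The function underlying an element of `Y₀`. -/
def Y₀.fn {W : Setting P} (y : W.Y₀) : Pt N → ℝ := y.1

/-- `(y, ȳ) = ∬_{q_T} ρ₀⁻² y ȳ + η ∬_{Q_T} ρ⁻² Ly Lȳ` on `Y₀`. -/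
def innerY₀ (y z : W.Y₀) : ℝ :=
  (∫ p in W.qT, (W.ρ₀ p) ^ (-2 : ℤ) * y.fn p * z.fn p) +
    W.η * ∫ p in P.QT, (W.ρ p) ^ (-2 : ℤ) * P.L y.fn p * P.L z.fn p

lemma memLp_obs (y : W.Y₀) : MemLp (fun p => (W.ρ₀ p)⁻¹ * y.fn p) 2 W.μq :=
  (memLp_two_of_top ((Problem.memLp_top_self y.2.1).mul
    (W.isWeight_ρ₀.memLp_inv W.ρstar_pos))).mono_measure W.μq_le

lemma memLp_res (y : W.Y₀) : MemLp (fun p => (W.ρ p)⁻¹ * P.L y.fn p) 2 P.μQ :=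
  memLp_two_of_top ((Problem.memLp_top_L y.2.1).mul
    (W.isWeight_ρ.memLp_inv W.ρstar_pos))

/-- `y ↦ ρ₀⁻¹ y ∈ L²(q_T)` on `Y₀`. -/
def obs₀ : W.Y₀ →ₗ[ℝ] Lp ℝ 2 W.μq where
  toFun y := (W.memLp_obs y).toLp _
  map_add' y z := by
    rw [← MemLp.toLp_add]
    refine MemLp.toLp_congr _ _ (ae_of_all _ fun p => ?_)
    exact mul_add _ _ _
  map_smul' a y := by
    rw [RingHom.id_apply, ← MemLp.toLp_const_smul]
    refine MemLp.toLp_congr _ _ (ae_of_all _ fun p => ?_)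
    exact mul_left_comm _ _ _

/-- `y ↦ ρ⁻¹ L y ∈ L²(Q_T)` on `Y₀`. -/
def res₀ : W.Y₀ →ₗ[ℝ] Lp ℝ 2 P.μQ where
  toFun y := (W.memLp_res y).toLp _
  map_add' y z := by
    rw [← MemLp.toLp_add]
    refine MemLp.toLp_congr _ _ ?_
    filter_upwards [ae_restrict_mem P.isOpen_QT.measurableSet] with p hp
    have := Problem.L_add y.2.1 z.2.1 hp
    change (W.ρ p)⁻¹ * P.L (y.fn + z.fn) p = (W.ρ p)⁻¹ * P.L y.fn p + (W.ρ p)⁻¹ * P.L z.fn p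
    rw [← mul_add]
    exact congrArg _ this
  map_smul' a y := by
    rw [RingHom.id_apply, ← MemLp.toLp_const_smul]
    refine MemLp.toLp_congr _ _ ?_
    filter_upwards [ae_restrict_mem P.isOpen_QT.measurableSet] with p hp
    have := Problem.L_smul a y.2.1 hp
    change (W.ρ p)⁻¹ * P.L (a • y.fn) p = a * ((W.ρ p)⁻¹ * P.L y.fn p)
    rw [mul_left_comm]
    exact congrArg _ this

lemma innerY₀_eq (y z : W.Y₀) : W.innerY₀ y z =
    inner ℝ (W.obs₀ y) (W.obs₀ z) + W.η * inner ℝ (W.res₀ y) (W.res₀ z) := by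
  unfold innerY₀
  rw [L2.inner_def, L2.inner_def]
  congr 1
  · refine integral_congr_ae ?_
    filter_upwards [(W.memLp_obs y).coeFn_toLp, (W.memLp_obs z).coeFn_toLp] with p h1 h2
    change _ = inner ℝ ((W.memLp_obs y).toLp _ p) ((W.memLp_obs z).toLp _ p)
    rw [h1, h2, zpow_neg]
    simp only [RCLike.inner_apply, conj_trivial, zpow_ofNat]
    rw [← inv_pow]
    ring
  · congr 1
    refine integral_congr_ae ?_
    filter_upwards [(W.memLp_res y).coeFn_toLp, (W.memLp_res z).coeFn_toLp] with p h1 h2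
    change _ = inner ℝ ((W.memLp_res y).toLp _ p) ((W.memLp_res z).toLp _ p)
    rw [h1, h2, zpow_neg]
    simp only [RCLike.inner_apply, conj_trivial, zpow_ofNat]
    rw [← inv_pow]
    ring

/-- The pre-inner product structure of `Y₀`. -/
abbrev coreY₀ : PreInnerProductSpace.Core ℝ W.Y₀ where
  inner := W.innerY₀
  conj_inner_symm y z := by
    simp only [innerY₀_eq, conj_trivial]
    rw [real_inner_comm, real_inner_comm (W.res₀ y)]
  re_inner_nonneg y := by
    simp only [innerY₀_eq, RCLike.re_to_real]
    exact add_nonneg real_inner_self_nonneg (mul_nonneg W.η_pos.le real_inner_self_nonneg)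
  add_left x y z := by
    simp only [innerY₀_eq, map_add, inner_add_left]
    ring
  smul_left x y a := by
    simp only [innerY₀_eq, map_smul, inner_smul_left, conj_trivial]
    ring

instance : SeminormedAddCommGroup W.Y₀ :=
  @InnerProductSpace.Core.toSeminormedAddCommGroup ℝ W.Y₀ _ _ _ W.coreY₀

instance : InnerProductSpace ℝ W.Y₀ := InnerProductSpace.ofCore W.coreY₀

lemma norm_sq_Y₀ (y : W.Y₀) : ‖y‖ ^ 2 = ‖W.obs₀ y‖ ^ 2 + W.η * ‖W.res₀ y‖ ^ 2 := by
  rw [← real_inner_self_eq_norm_sq, ← real_inner_self_eq_norm_sq, ← real_inner_self_eq_norm_sq]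
  exact W.innerY₀_eq y y

/-- The state space: the (Hausdorff) completion of `Y₀` for its scalar product. -/
abbrev Y : Type := UniformSpace.Completion W.Y₀

/-- `y ↦ ρ₀⁻¹ y ∈ L²(q_T)`, extended by continuity from `Y₀` to the completion. -/
def obs : W.Y →L[ℝ] Lp ℝ 2 W.μq :=
  (W.obs₀.mkContinuous 1 fun y => by
    rw [one_mul]
    refine le_of_sq_le_sq ?_ (norm_nonneg _)
    rw [W.norm_sq_Y₀]
    exact le_add_of_nonneg_right (mul_nonneg W.η_pos.le (sq_nonneg _))).extend
      UniformSpace.Completion.toComplL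

/-- `y ↦ ρ⁻¹ L y ∈ L²(Q_T)`, extended by continuity from `Y₀` to the completion. -/
def res : W.Y →L[ℝ] Lp ℝ 2 P.μQ :=
  (W.res₀.mkContinuous (√W.η)⁻¹ fun y => by
    have hη := Real.sqrt_pos.2 W.η_pos
    rw [inv_mul_eq_div, le_div_iff₀ hη]
    refine le_of_sq_le_sq ?_ (norm_nonneg _)
    rw [W.norm_sq_Y₀, mul_pow, Real.sq_sqrt W.η_pos.le, mul_comm]
    exact le_add_of_nonneg_left (sq_nonneg _)).extend
      UniformSpace.Completion.toComplL

lemma obs_coe (y : W.Y₀) : W.obs (y : W.Y) = W.obs₀ y :=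
  ContinuousLinearMap.extend_eq _ UniformSpace.Completion.denseRange_coe
    (UniformSpace.Completion.isUniformInducing_coe _) y

lemma res_coe (y : W.Y₀) : W.res (y : W.Y) = W.res₀ y :=
  ContinuousLinearMap.extend_eq _ UniformSpace.Completion.denseRange_coe
    (UniformSpace.Completion.isUniformInducing_coe _) y

end Setting

/-! ### The multiplier space -/

/-- The pairs `(φ, ∇φ)` in `L²(Ω) × L²(Ω)^N` with `φ ∈ C_c^∞(Ω)`. -/
def testGraph (P : Problem N) :
    Submodule ℝ (Lp ℝ 2 P.μΩ × Lp (EuclideanSpace ℝ (Fin N)) 2 P.μΩ) where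
  carrier := {q | ∃ φ : EuclideanSpace ℝ (Fin N) → ℝ, ContDiff ℝ (⊤ : ℕ∞) φ ∧
    HasCompactSupport φ ∧ tsupport φ ⊆ P.Ω ∧ q.1 =ᵐ[P.μΩ] φ ∧ q.2 =ᵐ[P.μΩ] gradient φ}
  add_mem' := by
    rintro q q' ⟨φ, h1, h2, h3, h4, h5⟩ ⟨ψ, k1, k2, k3, k4, k5⟩
    refine ⟨φ + ψ, h1.add k1, h2.add k2, (tsupport_add φ ψ).trans (union_subset h3 k3), ?_, ?_⟩
    · exact (Lp.coeFn_add _ _).trans (h4.add k4)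
    · refine (Lp.coeFn_add _ _).trans ((h5.add k5).trans (ae_of_all _ fun x => ?_))
      simp only [gradient, Pi.add_apply]
      rw [fderiv_add (h1.differentiable (by simp) x) (k1.differentiable (by simp) x), map_add]
  zero_mem' := by
    refine ⟨0, contDiff_const, HasCompactSupport.zero, by simp [tsupport], Lp.coeFn_zero _ _ _, ?_⟩
    refine (Lp.coeFn_zero _ _ _).trans (ae_of_all _ fun x => ?_)
    simp [gradient]
  smul_mem' := by
    rintro a q ⟨φ, h1, h2, h3, h4, h5⟩
    refine ⟨a • φ, h1.const_smul a, h2.smul_left (f := fun _ => a),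
      (tsupport_smul_subset_right (fun _ => a) φ).trans h3, ?_, ?_⟩
    · exact (Lp.coeFn_smul _ _).trans (h4.const_smul a)
    · refine (Lp.coeFn_smul _ _).trans ((h5.const_smul a).trans (ae_of_all _ fun x => ?_))
      simp only [gradient, Pi.smul_apply]
      rw [fderiv_const_smul (h1.differentiable (by simp) x), map_smul]

/-- The pairs `(v, ∇v)` with `v ∈ H¹₀(Ω)`: the closure in `L²(Ω) × L²(Ω)^N` of the pairs
`(φ, ∇φ)` with `φ ∈ C_c^∞(Ω)`. -/
def H10 (P : Problem N) :
    Submodule ℝ (Lp ℝ 2 P.μΩ × Lp (EuclideanSpace ℝ (Fin N)) 2 P.μΩ) :=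
  (testGraph P).topologicalClosure

/-- Test functions in `C_c^∞(Q_T)`. -/
structure IsTest (P : Problem N) (φ : Pt N → ℝ) : Prop where
  contDiff : ContDiff ℝ (⊤ : ℕ∞) φ
  hasCompactSupport : HasCompactSupport φ
  tsupport_subset : tsupport φ ⊆ P.QT

/-- For a function `u` on `Q_T` with spatial gradient `G`: the equation
`L⋆u = -u_t - ∇ · (c ∇u) + d u = g` in the sense of distributions on `Q_T`. -/
def IsWeakLstar (P : Problem N) (u : Pt N → ℝ) (G : Pt N → EuclideanSpace ℝ (Fin N))
    (g : Pt N → ℝ) : Prop :=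
  ∀ φ : Pt N → ℝ, IsTest P φ →
    ∫ p in P.QT, (u p * dt φ p + (∑ i, ∑ j, P.c p.1 i j * G p j * dx i φ p) + P.d p * u p * φ p) =
      ∫ p in P.QT, g p * φ p

/-- `u` has a representative `z ∈ C⁰([0, T]; L²(Ω))` with `z(T) = 0`, it vanishes on `Σ_T` in the
sense that `u ∈ L²(0, T; H¹₀(Ω))`, with spatial gradient `G ∈ L²(Q_T)^N`, and
`ρ₀ L⋆u = h ∈ L²(Q_T)`, the operator `L⋆` being taken in the sense of distributions. -/
structure Setting.IsBackward {P : Problem N} (W : Setting P) (u : Pt N → ℝ)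
    (z : ℝ → Lp ℝ 2 P.μΩ) (G : Lp (EuclideanSpace ℝ (Fin N)) 2 P.μQ) (h : Lp ℝ 2 P.μQ) :
    Prop where
  continuousOn : ContinuousOn z (Icc 0 P.T)
  slice : ∀ᵐ t ∂(volume.restrict (Ioo 0 P.T)), (fun x => u (x, t)) =ᵐ[P.μΩ] z t
  terminal : z P.T = 0
  dirichlet : ∀ᵐ t ∂(volume.restrict (Ioo 0 P.T)),
    ∃ γ : Lp (EuclideanSpace ℝ (Fin N)) 2 P.μΩ, (z t, γ) ∈ H10 P ∧
      (fun x => G (x, t)) =ᵐ[P.μΩ] γ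
  equation : IsWeakLstar P u G fun p => (W.ρ₀ p)⁻¹ * h p

/-! ### Uniqueness and linearity of `u ↦ ρ₀ L⋆u` -/

lemma H10_grad_eq_zero {P : Problem N} {γ : Lp (EuclideanSpace ℝ (Fin N)) 2 P.μΩ}
    (hγ : ((0 : Lp ℝ 2 P.μΩ), γ) ∈ H10 P) : γ = 0 := by
  have key : ∀ i : Fin N, ∀ ψ : EuclideanSpace ℝ (Fin N) → ℝ, ContDiff ℝ (⊤ : ℕ∞) ψ →
      HasCompactSupport ψ → ∫ x in P.Ω, ψ x • γ x i = 0 := by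
    intro i ψ hψ hψc
    have hdψ : Continuous (fun x => fderiv ℝ ψ x (EuclideanSpace.single i 1)) :=
      (hψ.continuous_fderiv (by simp)).clm_apply continuous_const
    have hdψc : HasCompactSupport (fun x => fderiv ℝ ψ x (EuclideanSpace.single i 1)) :=
      hψc.fderiv_apply ℝ _
    have m1 : MemLp (fun x => fderiv ℝ ψ x (EuclideanSpace.single i 1)) 2 P.μΩ :=
      (hdψ.memLp_of_hasCompactSupport hdψc).restrict _
    have m2 : MemLp (fun x => ψ x • (EuclideanSpace.single i (1 : ℝ))) 2 P.μΩ :=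
      ((hψ.continuous.smul continuous_const).memLp_of_hasCompactSupport
        (hψc.smul_right (f' := fun _ => EuclideanSpace.single i (1 : ℝ)))).restrict _
    let F : Lp ℝ 2 P.μΩ × Lp (EuclideanSpace ℝ (Fin N)) 2 P.μΩ → ℝ := fun q =>
      inner ℝ (m1.toLp _) q.1 + inner ℝ (m2.toLp _) q.2
    have hF : Continuous F := by fun_prop
    have hsub : (H10 P : Set _) ⊆ F ⁻¹' {0} := by
      refine closure_minimal ?_ (isClosed_singleton.preimage hF)
      rintro q ⟨φ, h1, h2, h3, h4, h5⟩
      change F q = 0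
      have e1 : inner ℝ (m1.toLp _) q.1 =
          ∫ x in P.Ω, φ x * fderiv ℝ ψ x (EuclideanSpace.single i 1) := by
        rw [L2.inner_def]
        refine integral_congr_ae ?_
        filter_upwards [m1.coeFn_toLp, h4] with x a b
        rw [a, b]
        simp
      have e2 : inner ℝ (m2.toLp _) q.2 =
          ∫ x in P.Ω, fderiv ℝ φ x (EuclideanSpace.single i 1) * ψ x := by
        rw [L2.inner_def]
        refine integral_congr_ae ?_
        filter_upwards [m2.coeFn_toLp, h5] with x a b
        rw [a, b, inner_smul_left, real_inner_comm, inner_gradient_left]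
        simp [mul_comm]
      have s1 : ∫ x in P.Ω, φ x * fderiv ℝ ψ x (EuclideanSpace.single i 1) =
          ∫ x, φ x * fderiv ℝ ψ x (EuclideanSpace.single i 1) := by
        refine setIntegral_eq_integral_of_forall_compl_eq_zero fun x hx => ?_
        rw [image_eq_zero_of_notMem_tsupport fun h => hx (h3 h), zero_mul]
      have s2 : ∫ x in P.Ω, fderiv ℝ φ x (EuclideanSpace.single i 1) * ψ x =
          ∫ x, fderiv ℝ φ x (EuclideanSpace.single i 1) * ψ x := by
        refine setIntegral_eq_integral_of_forall_compl_eq_zero fun x hx => ?_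
        have : fderiv ℝ φ x = 0 :=
          image_eq_zero_of_notMem_tsupport fun h => hx (h3 (tsupport_fderiv_subset ℝ h))
        rw [this]
        simp
      have hdφ : Continuous (fun x => fderiv ℝ φ x (EuclideanSpace.single i 1)) :=
        (h1.continuous_fderiv (by simp)).clm_apply continuous_const
      have ibp := integral_mul_fderiv_eq_neg_fderiv_mul_of_integrable
        (f := φ) (g := ψ) (v := EuclideanSpace.single i 1) (μ := volume)
        ((hdφ.mul hψ.continuous).integrable_of_hasCompactSupport hψc.mul_left)
        ((h1.continuous.mul hdψ).integrable_of_hasCompactSupport h2.mul_right)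
        ((h1.continuous.mul hψ.continuous).integrable_of_hasCompactSupport h2.mul_right)
        (fun x _ => h1.differentiable (by simp) x) (fun x _ => hψ.differentiable (by simp) x)
      change inner ℝ (m1.toLp _) q.1 + inner ℝ (m2.toLp _) q.2 = 0
      rw [e1, e2, s1, s2, ibp]
      simp
    have h0 : F (0, γ) = 0 := hsub hγ
    have h1 : inner ℝ (m2.toLp _) γ = ∫ x in P.Ω, ψ x • γ x i := by
      rw [L2.inner_def]
      refine integral_congr_ae ?_
      filter_upwards [m2.coeFn_toLp] with x a
      rw [a, inner_smul_left, EuclideanSpace.inner_single_left]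
      simp
    rw [← h1]
    simpa [F] using h0
  have hint : ∀ i, LocallyIntegrable (fun x => γ x i) P.μΩ := fun i => by
    have hm : MemLp (fun x => γ x i) 2 P.μΩ :=
      (EuclideanSpace.proj (𝕜 := ℝ) i).comp_memLp' (Lp.memLp γ)
    exact hm.locallyIntegrable (by norm_num)
  have hz : ∀ i, ∀ᵐ x ∂P.μΩ, γ x i = 0 := fun i =>
    ae_eq_zero_of_integral_contDiff_smul_eq_zero (hint i) fun ψ hψ hψc => key i ψ hψ hψc
  rw [Lp.eq_zero_iff_ae_eq_zero]
  filter_upwards [ae_all_iff.2 hz] with x hx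
  ext i
  simpa using hx i

lemma μQ_eq_prod (P : Problem N) : P.μQ = P.μΩ.prod (volume.restrict (Ioo 0 P.T)) := by
  rw [Measure.prod_restrict, ← Measure.volume_eq_prod]
  rfl

lemma ae_slice {P : Problem N} {A : Pt N → Prop} (h : ∀ᵐ p ∂P.μQ, A p) :
    ∀ᵐ t ∂(volume.restrict (Ioo 0 P.T)), ∀ᵐ x ∂P.μΩ, A (x, t) := by
  rw [μQ_eq_prod] at h
  exact Measure.ae_ae_of_ae_prod
    (Measure.measurePreserving_swap.quasiMeasurePreserving.ae h)

lemma IsTest.contDiffOn {P : Problem N} {φ : Pt N → ℝ} (hφ : IsTest P φ) :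
    ContDiffOn ℝ 2 φ (closure P.QT) :=
  (contDiff_infty.1 hφ.contDiff 2).contDiffOn

lemma integrable_lhs {P : Problem N} {u : Pt N → ℝ} (hu : MemLp u 2 P.μQ)
    (G : Lp (EuclideanSpace ℝ (Fin N)) 2 P.μQ) {φ : Pt N → ℝ} (hφ : IsTest P φ) :
    IntegrableOn (fun p => u p * dt φ p +
      (∑ i, ∑ j, P.c p.1 i j * G p j * dx i φ p) + P.d p * u p * φ p) P.QT := by
  have hG : ∀ j, MemLp (fun p => G p j) 2 P.μQ := fun j =>
    (EuclideanSpace.proj (𝕜 := ℝ) j).comp_memLp' (Lp.memLp G)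
  have h : MemLp (fun p => u p * dt φ p +
      (∑ i, ∑ j, P.c p.1 i j * G p j * dx i φ p) + P.d p * u p * φ p) 2 P.μQ := by
    refine MemLp.add (MemLp.add ?_ ?_) ?_
    · exact (Problem.memLp_top_fderiv hφ.contDiffOn _).mul hu
    · refine memLp_finsetSum _ fun i _ => memLp_finsetSum _ fun j _ => ?_
      exact MemLp.mul (r := 2) (Problem.memLp_top_fderiv hφ.contDiffOn _)
        (MemLp.mul (r := 2) (hG j) (Problem.memLp_top_c i j))
    · exact MemLp.mul (r := 2) (Problem.memLp_top_self hφ.contDiffOn)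
        (MemLp.mul (r := 2) hu P.memLp_d)
  exact h.integrable (by norm_num)

namespace Setting

variable {P : Problem N} (W : Setting P)

lemma memLp_source (h : Lp ℝ 2 P.μQ) : MemLp (fun p => (W.ρ₀ p)⁻¹ * h p) 2 P.μQ :=
  (Lp.memLp h).mul (W.isWeight_ρ₀.memLp_inv W.ρstar_pos)

lemma integrable_rhs (h : Lp ℝ 2 P.μQ) {φ : Pt N → ℝ} (hφ : IsTest P φ) :
    IntegrableOn (fun p => (W.ρ₀ p)⁻¹ * h p * φ p) P.QT := by
  have : MemLp (fun p => (W.ρ₀ p)⁻¹ * h p * φ p) 2 P.μQ :=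
    MemLp.mul (r := 2) (Problem.memLp_top_self hφ.contDiffOn) (W.memLp_source h)
  exact this.integrable (by norm_num)

variable {W}

lemma IsBackward.unique {u : Pt N → ℝ} {z z' : ℝ → Lp ℝ 2 P.μΩ}
    {G G' : Lp (EuclideanSpace ℝ (Fin N)) 2 P.μQ} {h h' : Lp ℝ 2 P.μQ}
    (H : W.IsBackward u z G h) (H' : W.IsBackward u z' G' h') : h = h' := by
  have hG : G =ᵐ[P.μQ] G' := by
    have hm : MeasurableSet {q : Pt N | G q = G' q} :=
      measurableSet_eq_fun (Lp.stronglyMeasurable G).measurable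
        (Lp.stronglyMeasurable G').measurable
    have hpr : (∀ᵐ p ∂P.μQ, G p = G' p) ↔
        ∀ᵐ t ∂(volume.restrict (Ioo 0 P.T)), ∀ᵐ x ∂P.μΩ, G (x, t) = G' (x, t) := by
      refine Iff.trans ?_ ((Measure.ae_prod_iff_ae_ae hm).trans (Measure.ae_ae_comm hm))
      rw [← μQ_eq_prod]
    refine hpr.2 ?_
    filter_upwards [H.slice, H'.slice, H.dirichlet, H'.dirichlet] with t s s' ⟨γ, hγ, e⟩
      ⟨γ', hγ', e'⟩
    have hz : z t = z' t := Lp.ext (s.symm.trans s')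
    have hd := (H10 P).sub_mem hγ hγ'
    rw [Prod.mk_sub_mk, hz, sub_self] at hd
    rw [sub_eq_zero.1 (H10_grad_eq_zero hd)] at e
    exact e.trans e'.symm
  have hzero : ∀ᵐ p ∂volume, p ∈ P.QT →
      (W.ρ₀ p)⁻¹ * h p - (W.ρ₀ p)⁻¹ * h' p = 0 := by
    refine P.isOpen_QT.ae_eq_zero_of_integral_contDiff_smul_eq_zero ?_ ?_
    · have : MemLp (fun p => (W.ρ₀ p)⁻¹ * h p - (W.ρ₀ p)⁻¹ * h' p) 2 P.μQ :=
        (W.memLp_source h).sub (W.memLp_source h')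
      exact IntegrableOn.locallyIntegrableOn (this.integrable (by norm_num))
    · intro φ h1 h2 h3
      have hφ : IsTest P φ := ⟨h1, h2, h3⟩
      have a := H.equation φ hφ
      have a' := H'.equation φ hφ
      have hl : ∫ p in P.QT, (u p * dt φ p + (∑ i, ∑ j, P.c p.1 i j * G p j * dx i φ p) +
          P.d p * u p * φ p) = ∫ p in P.QT, (u p * dt φ p +
          (∑ i, ∑ j, P.c p.1 i j * G' p j * dx i φ p) + P.d p * u p * φ p) := by
        refine integral_congr_ae ?_
        filter_upwards [hG] with p hp
        simp only [hp]
      rw [← setIntegral_eq_integral_of_forall_compl_eq_zero (s := P.QT) fun p hp => by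
        rw [image_eq_zero_of_notMem_tsupport fun h => hp (h3 h), zero_smul]]
      have hr := integral_sub (W.integrable_rhs h hφ) (W.integrable_rhs h' hφ)
      rw [← a, ← a', hl, sub_self] at hr
      rw [← hr]
      refine integral_congr_ae (ae_of_all _ fun p => ?_)
      simp only [smul_eq_mul]
      ring
  refine Lp.ext ?_
  have := (ae_restrict_iff' P.isOpen_QT.measurableSet).2 hzero
  filter_upwards [this, ae_restrict_mem P.isOpen_QT.measurableSet] with p hp hpQ
  have hpos := inv_pos.2 (W.isWeight_ρ₀.pos W.ρstar_pos hpQ)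
  rw [← mul_sub] at hp
  exact sub_eq_zero.1 ((mul_eq_zero.1 hp).resolve_left hpos.ne')

lemma IsBackward.congr {u v : Pt N → ℝ} {z : ℝ → Lp ℝ 2 P.μΩ}
    {G : Lp (EuclideanSpace ℝ (Fin N)) 2 P.μQ} {h : Lp ℝ 2 P.μQ}
    (H : W.IsBackward u z G h) (huv : v =ᵐ[P.μQ] u) : W.IsBackward v z G h where
  continuousOn := H.continuousOn
  slice := by
    filter_upwards [H.slice, ae_slice huv] with t a b
    exact EventuallyEq.trans b a
  terminal := H.terminal
  dirichlet := H.dirichlet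
  equation φ hφ := by
    rw [← H.equation φ hφ]
    refine integral_congr_ae ?_
    filter_upwards [huv] with p hp
    rw [hp]

lemma IsBackward.add {u u' : Pt N → ℝ} (hu : MemLp u 2 P.μQ) (hu' : MemLp u' 2 P.μQ)
    {z z' : ℝ → Lp ℝ 2 P.μΩ}
    {G G' : Lp (EuclideanSpace ℝ (Fin N)) 2 P.μQ} {h h' : Lp ℝ 2 P.μQ}
    (H : W.IsBackward u z G h) (H' : W.IsBackward u' z' G' h') :
    W.IsBackward (u + u') (z + z') (G + G') (h + h') where
  continuousOn := H.continuousOn.add H'.continuousOn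
  slice := by
    filter_upwards [H.slice, H'.slice] with t a b
    exact (a.add b).trans (Lp.coeFn_add _ _).symm
  terminal := by simp [H.terminal, H'.terminal]
  dirichlet := by
    filter_upwards [H.dirichlet, H'.dirichlet, ae_slice (Lp.coeFn_add G G')] with t
      ⟨γ, a, b⟩ ⟨γ', a', b'⟩ e
    exact ⟨γ + γ', (H10 P).add_mem a a',
      (EventuallyEq.trans e (b.add b')).trans (Lp.coeFn_add _ _).symm⟩
  equation φ hφ := by
    have e1 := integral_add (integrable_lhs hu G hφ) (integrable_lhs hu' G' hφ)
    have e2 := integral_add (W.integrable_rhs h hφ) (W.integrable_rhs h' hφ)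
    rw [H.equation φ hφ, H'.equation φ hφ, ← e2] at e1
    refine Eq.trans (integral_congr_ae ?_) (e1.trans (integral_congr_ae ?_))
    · filter_upwards [Lp.coeFn_add G G'] with p hp
      simp only [hp, Pi.add_apply, PiLp.add_apply, mul_add, add_mul, Finset.sum_add_distrib]
      ring
    · filter_upwards [Lp.coeFn_add h h'] with p hp
      simp only [hp, Pi.add_apply]
      ring

lemma IsBackward.smul (a : ℝ) {u : Pt N → ℝ} {z : ℝ → Lp ℝ 2 P.μΩ}
    {G : Lp (EuclideanSpace ℝ (Fin N)) 2 P.μQ} {h : Lp ℝ 2 P.μQ}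
    (H : W.IsBackward u z G h) : W.IsBackward (a • u) (a • z) (a • G) (a • h) where
  continuousOn := H.continuousOn.const_smul a
  slice := by
    filter_upwards [H.slice] with t e
    exact (e.const_smul a).trans (Lp.coeFn_smul _ _).symm
  terminal := by simp [H.terminal]
  dirichlet := by
    filter_upwards [H.dirichlet, ae_slice (Lp.coeFn_smul a G)] with t ⟨γ, h1, h2⟩ e
    exact ⟨a • γ, (H10 P).smul_mem a h1,
      (EventuallyEq.trans e (h2.const_smul a)).trans (Lp.coeFn_smul _ _).symm⟩
  equation φ hφ := by
    have e := congrArg (a * ·) (H.equation φ hφ)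
    simp only [← integral_const_mul] at e
    refine Eq.trans (integral_congr_ae ?_) (e.trans (integral_congr_ae ?_))
    · filter_upwards [Lp.coeFn_smul a G] with p hp
      simp only [hp, Pi.smul_apply, PiLp.smul_apply, smul_eq_mul, mul_add, Finset.mul_sum]
      congr 1
      · congr 1
        · ring
        · refine Finset.sum_congr rfl fun i _ => Finset.sum_congr rfl fun j _ => ?_
          ring
      · ring
    · filter_upwards [Lp.coeFn_smul a h] with p hp
      simp only [hp, Pi.smul_apply, smul_eq_mul]
      ring

lemma IsBackward.zero : W.IsBackward 0 0 0 0 where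
  continuousOn := continuousOn_const
  slice := ae_of_all _ fun t => (Lp.coeFn_zero _ _ _).symm
  terminal := rfl
  dirichlet := by
    filter_upwards [ae_slice (Lp.coeFn_zero (EuclideanSpace ℝ (Fin N)) 2 P.μQ)] with t e
    exact ⟨0, (H10 P).zero_mem, EventuallyEq.trans e (Lp.coeFn_zero _ _ _).symm⟩
  equation φ hφ := by
    have e1 : ∀ᵐ p ∂P.μQ, (0 : Lp (EuclideanSpace ℝ (Fin N)) 2 P.μQ) p = 0 := Lp.coeFn_zero _ _ _
    have e2 : ∀ᵐ p ∂P.μQ, (0 : Lp ℝ 2 P.μQ) p = 0 := Lp.coeFn_zero _ _ _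
    refine integral_congr_ae ?_
    filter_upwards [e1, e2] with p h1 h2
    simp only [h1, h2]
    simp

variable (W)

lemma memLp_scaled (l : Lp ℝ 2 P.μQ) : MemLp (fun p => (W.ρ p)⁻¹ * l p) 2 P.μQ :=
  (Lp.memLp l).mul (W.isWeight_ρ.memLp_inv W.ρstar_pos)

/-- The multipliers `λ` with `ρ⁻¹λ ∈ C⁰([0,T]; L²(Ω))`, `ρ₀ L⋆(ρ⁻¹λ) ∈ L²(Q_T)`, `ρ⁻¹λ = 0` on
`Σ_T` and `(ρ⁻¹λ)(·, T) = 0`. As `ρ` is bounded, such a `λ` lies in `L²(Q_T)`. -/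
def multiplierSubmodule : Submodule ℝ (Lp ℝ 2 P.μQ) where
  carrier := {l | ∃ z G h, W.IsBackward (fun p => (W.ρ p)⁻¹ * l p) z G h}
  add_mem' := by
    rintro l l' ⟨z, G, h, H⟩ ⟨z', G', h', H'⟩
    refine ⟨_, _, _, (H.add (W.memLp_scaled l) (W.memLp_scaled l') H').congr ?_⟩
    filter_upwards [Lp.coeFn_add l l'] with p hp
    simp only [hp, Pi.add_apply, mul_add]
  zero_mem' := by
    refine ⟨_, _, _, IsBackward.zero.congr ?_⟩
    filter_upwards [Lp.coeFn_zero ℝ 2 P.μQ] with p hp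
    simp only [hp, Pi.zero_apply, mul_zero]
  smul_mem' := by
    rintro a l ⟨z, G, h, H⟩
    refine ⟨_, _, _, (H.smul a).congr ?_⟩
    filter_upwards [Lp.coeFn_smul a l] with p hp
    simp only [hp, Pi.smul_apply, smul_eq_mul]
    ring

/-- The multiplier space `Λ`, to be normed by its own scalar product. -/
def Lam : Type := W.multiplierSubmodule

instance : AddCommGroup W.Lam := inferInstanceAs (AddCommGroup W.multiplierSubmodule)

instance : Module ℝ W.Lam := inferInstanceAs (Module ℝ W.multiplierSubmodule)

variable {W} in
/-- The element of `L²(Q_T)` underlying `λ ∈ Λ`. -/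
def Lam.fn (l : W.Lam) : Lp ℝ 2 P.μQ := l.1

variable {W} in
lemma Lam.exists_wLstar (l : W.Lam) :
    ∃ h, ∃ z G, W.IsBackward (fun p => (W.ρ p)⁻¹ * l.fn p) z G h := by
  obtain ⟨z, G, h, H⟩ := l.2
  exact ⟨h, z, G, H⟩

/-- `λ ↦ ρ₀ L⋆(ρ⁻¹λ) ∈ L²(Q_T)` on `Λ`. -/
def wLstar : W.Lam →ₗ[ℝ] Lp ℝ 2 P.μQ where
  toFun l := l.exists_wLstar.choose
  map_add' l l' := by
    obtain ⟨z, G, H⟩ := l.exists_wLstar.choose_spec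
    obtain ⟨z', G', H'⟩ := l'.exists_wLstar.choose_spec
    obtain ⟨z₂, G₂, H₂⟩ := (l + l').exists_wLstar.choose_spec
    refine H₂.unique ((H.add (W.memLp_scaled _) (W.memLp_scaled _) H').congr ?_)
    filter_upwards [Lp.coeFn_add l.fn l'.fn] with p hp
    change (W.ρ p)⁻¹ * (l.fn + l'.fn : Lp ℝ 2 P.μQ) p = _
    simp only [hp, Pi.add_apply, mul_add]
  map_smul' a l := by
    obtain ⟨z, G, H⟩ := l.exists_wLstar.choose_spec
    obtain ⟨z₂, G₂, H₂⟩ := (a • l).exists_wLstar.choose_spec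
    refine H₂.unique ((H.smul a).congr ?_)
    filter_upwards [Lp.coeFn_smul a l.fn] with p hp
    change (W.ρ p)⁻¹ * (a • l.fn : Lp ℝ 2 P.μQ) p = _
    simp only [hp, Pi.smul_apply, smul_eq_mul]
    ring

lemma wLstar_spec (l : W.Lam) :
    ∃ z G, W.IsBackward (fun p => (W.ρ p)⁻¹ * l.fn p) z G (W.wLstar l) :=
  l.exists_wLstar.choose_spec

/-- The function `L⋆(ρ⁻¹λ)` on `Q_T`, for `λ ∈ Λ`. -/
def Lstar (l : W.Lam) (p : Pt N) : ℝ := (W.ρ₀ p)⁻¹ * W.wLstar l p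

/-- `⟨λ, λ̄⟩ = ∬_{Q_T} (ρ⁻² λ λ̄ + ρ₀² L⋆(ρ⁻¹λ) L⋆(ρ⁻¹λ̄))` on `Λ`. -/
def innerLam (l m : W.Lam) : ℝ :=
  ∫ p in P.QT, ((W.ρ p) ^ (-2 : ℤ) * l.fn p * m.fn p +
    (W.ρ₀ p) ^ 2 * W.Lstar l p * W.Lstar m p)

/-- `λ ↦ ρ⁻¹λ ∈ L²(Q_T)` on `Λ`. -/
def scaled : W.Lam →ₗ[ℝ] Lp ℝ 2 P.μQ where
  toFun l := (W.memLp_scaled l.fn).toLp _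
  map_add' l m := by
    rw [← MemLp.toLp_add]
    refine MemLp.toLp_congr _ _ ?_
    filter_upwards [Lp.coeFn_add l.fn m.fn] with p hp
    change (W.ρ p)⁻¹ * (l.fn + m.fn : Lp ℝ 2 P.μQ) p = _
    simp only [hp, Pi.add_apply, mul_add]
  map_smul' a l := by
    rw [RingHom.id_apply, ← MemLp.toLp_const_smul]
    refine MemLp.toLp_congr _ _ ?_
    filter_upwards [Lp.coeFn_smul a l.fn] with p hp
    change (W.ρ p)⁻¹ * (a • l.fn : Lp ℝ 2 P.μQ) p = _
    simp only [hp, Pi.smul_apply, smul_eq_mul]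
    ring

lemma scaled_coeFn (l : W.Lam) : W.scaled l =ᵐ[P.μQ] fun p => (W.ρ p)⁻¹ * l.fn p :=
  (W.memLp_scaled l.fn).coeFn_toLp

lemma innerLam_eq (l m : W.Lam) : W.innerLam l m =
    inner ℝ (W.scaled l) (W.scaled m) + inner ℝ (W.wLstar l) (W.wLstar m) := by
  unfold innerLam
  rw [L2.inner_def, L2.inner_def, ← integral_add (L2.integrable_inner _ _)
    (L2.integrable_inner _ _)]
  refine integral_congr_ae ?_
  filter_upwards [W.scaled_coeFn l, W.scaled_coeFn m,
    ae_restrict_mem P.isOpen_QT.measurableSet] with p h1 h2 hp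
  have h0 := (W.isWeight_ρ₀.pos W.ρstar_pos hp).ne'
  rw [h1, h2, zpow_neg]
  simp only [RCLike.inner_apply, conj_trivial, zpow_ofNat, Lstar]
  rw [← inv_pow]
  field_simp

/-- The inner product structure of `Λ`. -/
abbrev coreLam : InnerProductSpace.Core ℝ W.Lam where
  inner := W.innerLam
  conj_inner_symm y z := by
    simp only [innerLam_eq, conj_trivial]
    rw [real_inner_comm, real_inner_comm (W.wLstar y)]
  re_inner_nonneg y := by
    simp only [innerLam_eq, RCLike.re_to_real]
    exact add_nonneg real_inner_self_nonneg real_inner_self_nonneg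
  add_left x y z := by
    simp only [innerLam_eq, map_add, inner_add_left]
    ring
  smul_left x y a := by
    simp only [innerLam_eq, map_smul, inner_smul_left, conj_trivial]
    ring
  definite l hl := by
    simp only [innerLam_eq] at hl
    have h0 : inner ℝ (W.scaled l) (W.scaled l) = 0 :=
      le_antisymm (by linarith [real_inner_self_nonneg (x := W.wLstar l)]) real_inner_self_nonneg
    rw [inner_self_eq_zero, Lp.eq_zero_iff_ae_eq_zero] at h0
    refine Subtype.ext (Lp.eq_zero_iff_ae_eq_zero.2 ?_)
    filter_upwards [h0, W.scaled_coeFn l, ae_restrict_mem P.isOpen_QT.measurableSet]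
      with p a b hp
    rw [b] at a
    exact (mul_eq_zero.1 a).resolve_left (inv_pos.2 (W.isWeight_ρ.pos W.ρstar_pos hp)).ne'

instance : NormedAddCommGroup W.Lam :=
  @InnerProductSpace.Core.toNormedAddCommGroup ℝ W.Lam _ _ _ W.coreLam

instance : InnerProductSpace ℝ W.Lam := InnerProductSpace.ofCore W.coreLam.toCore

lemma norm_sq_Lam (l : W.Lam) : ‖l‖ ^ 2 = ‖W.scaled l‖ ^ 2 + ‖W.wLstar l‖ ^ 2 := by
  rw [← real_inner_self_eq_norm_sq, ← real_inner_self_eq_norm_sq, ← real_inner_self_eq_norm_sq]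
  exact W.innerLam_eq l l

/-! ### The stabilized mixed formulation -/

/-- `a_{r,α}(y, ȳ) = (1-α) ∬_{q_T} ρ₀⁻² y ȳ + r ∬_{Q_T} ρ⁻² Ly Lȳ`. -/
def a (α r : ℝ) (y y' : W.Y) : ℝ :=
  (1 - α) * (∫ p in W.qT, W.obs y p * W.obs y' p) + r * ∫ p in P.QT, W.res y p * W.res y' p

/-- `b_α(y, λ) = ∬_{Q_T} ρ⁻¹Ly λ - α ∬_{q_T} L⋆(ρ⁻¹λ) y`, where `y = ρ₀ (ρ₀⁻¹ y)`. -/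
def b (α : ℝ) (y : W.Y) (l : W.Lam) : ℝ :=
  (∫ p in P.QT, W.res y p * l.fn p) -
    α * ∫ p in W.qT, W.Lstar l p * (W.ρ₀ p * W.obs y p)

/-- `c_α(λ, λ̄) = α ∬_{Q_T} ρ₀² L⋆(ρ⁻¹λ) L⋆(ρ⁻¹λ̄)`. -/
def c (α : ℝ) (l l' : W.Lam) : ℝ :=
  α * ∫ p in P.QT, (W.ρ₀ p) ^ 2 * W.Lstar l p * W.Lstar l' p

/-- `l_{1,α}(y) = (1-α) ∬_{q_T} ρ₀⁻² y_obs y`. -/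
def l₁ (α : ℝ) (yobs : Lp ℝ 2 W.μq) (y : W.Y) : ℝ :=
  (1 - α) * ∫ p in W.qT, (W.ρ₀ p)⁻¹ * yobs p * W.obs y p

/-- `l_{2,α}(λ) = -α ∬_{q_T} y_obs L⋆(ρ⁻¹λ)`. -/
def l₂ (α : ℝ) (yobs : Lp ℝ 2 W.μq) (l : W.Lam) : ℝ :=
  -α * ∫ p in W.qT, yobs p * W.Lstar l p

/-- `C` is a constant with `‖ρ⁻¹λ‖_{L²(Q_T)} ≤ C ‖L⋆(ρ⁻¹λ)‖_{L²(Q_T)}` for all `λ ∈ Λ`. -/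
def IsEnergyConstant (C : ℝ) : Prop :=
  ∀ l : W.Lam, √(∫ p in P.QT, ((W.ρ p)⁻¹ * l.fn p) ^ 2) ≤ C * √(∫ p in P.QT, (W.Lstar l p) ^ 2)

end Setting

/-- `(y, m)` solves the mixed problem `a(y, ȳ) + b(ȳ, m) = f(ȳ)` for all `ȳ`,
`b(y, m̄) - c(m, m̄) = g(m̄)` for all `m̄`. -/
def IsMixedSolution {V M : Type*} (a : V → V → ℝ) (b : V → M → ℝ) (c : M → M → ℝ)
    (f : V → ℝ) (g : M → ℝ) (y : V) (m : M) : Prop :=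
  (∀ y', a y y' + b y' m = f y') ∧ ∀ m', b y m' - c m m' = g m'

/-- Well-posedness of a mixed problem: for all continuous linear right-hand sides there is exactly
one solution, and it depends linearly and continuously on them. -/
def MixedWellPosed {V M : Type*} [NormedAddCommGroup V] [NormedSpace ℝ V]
    [NormedAddCommGroup M] [NormedSpace ℝ M]
    (a : V → V → ℝ) (b : V → M → ℝ) (c : M → M → ℝ) : Prop :=
  ∃ S : ((V →L[ℝ] ℝ) × (M →L[ℝ] ℝ)) →L[ℝ] V × M,
    ∀ (f : V →L[ℝ] ℝ) (g : M →L[ℝ] ℝ) (y : V) (m : M),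
      IsMixedSolution a b c f g y m ↔ (y, m) = S (f, g)

end ParabolicInverse

end

noncomputable section

namespace ParabolicInverse

variable {N : ℕ}

/-! ### Time translations -/

section Inner

variable {X E : Type*} [MeasurableSpace X] {μ : Measure X} [NormedAddCommGroup E]
  [InnerProductSpace ℝ E]

/-! On the Hilbert space `Y × Λ` consider F((y, λ), (ȳ, λ̄)) = a(y, ȳ) + b(ȳ, λ) - b(y, λ̄) + c(λ,
λ̄). The two occurrences of b cancel on the diagonal, so F is coercive as soon as a and c are, and
Lax–Milgram gives well-posedness with no inf-sup condition on b (`mixedWellPosed_of_coercive`); this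
is what the stabilization α > 0 buys. Coercivity of a is read off the norm of `Y`. Testing (M) with
its own solution and using Young's inequality gives the bound in 3 (`solution_estimate`). Two facts
about `Λ` remain: c controls the full norm, which follows from the inequality in 1 and ρ₀ ≥ ρ_⋆, and
`Λ` is complete.

Both come from one estimate for the backward problem (`exists_energy_estimate`): if L⋆u = g, u(T) =
0 and u = 0 on Σ_T, then sup_t ‖u(t)‖², ‖∇u‖² and ‖u‖² are at most C‖g‖², with C depending only on
T, c₀ and a bound for d. The last bound is 1. The other two, applied to differences in a Cauchy
sequence, make the traces converge uniformly in time and the gradients converge in L², so the limit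
is again a multiplier (`exists_isBackward_limit`).

Formally the estimate is d/dt ‖u‖² = 2 ∫ (c∇u·∇u + d u² - g u), followed by ellipticity and
Gronwall. The work lies in justifying this identity for a merely distributional solution. With A =
c∇u and f = du - g, test functions φ(x)ψ(t) yield ⟨v, u(b) - u(a)⟩ = ∫_a^b ∫ (A·∇v + f v) for v ∈
C_c^∞(Ω), hence for v ∈ H¹₀(Ω) by closure. The choices v = u(t) and v = u(t+h) on the interval from
t to t+h add up to ‖u(t+h)‖² - ‖u(t)‖². After integration over t > τ and division by h, the limit h
→ 0 needs only the continuity of translations in L²; no time derivative in a dual space appears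
(`norm_sq_eq_of_weak_equation`). -/

lemma inner_toLp {f g : X → E} (hf : MemLp f 2 μ) (hg : MemLp g 2 μ) :
    inner ℝ (hf.toLp f) (hg.toLp g) = ∫ x, inner ℝ (f x) (g x) ∂μ := by
  rw [L2.inner_def]
  refine integral_congr_ae ?_
  filter_upwards [hf.coeFn_toLp, hg.coeFn_toLp] with x h1 h2
  rw [h1, h2]

lemma integrable_inner_of_memLp {f g : X → E} (hf : MemLp f 2 μ) (hg : MemLp g 2 μ) :
    Integrable (fun x => inner ℝ (f x) (g x)) μ := by
  refine (L2.integrable_inner (𝕜 := ℝ) (hf.toLp f) (hg.toLp g)).congr ?_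
  filter_upwards [hf.coeFn_toLp, hg.coeFn_toLp] with x h1 h2
  rw [h1, h2]

lemma norm_toLp_sq {f : X → E} (hf : MemLp f 2 μ) :
    ‖hf.toLp f‖ ^ 2 = ∫ x, ‖f x‖ ^ 2 ∂μ := by
  rw [← real_inner_self_eq_norm_sq, inner_toLp]
  simp only [real_inner_self_eq_norm_sq]

lemma norm_Lp_sq (f : Lp E 2 μ) : ‖f‖ ^ 2 = ∫ x, ‖f x‖ ^ 2 ∂μ := by
  rw [← norm_toLp_sq (Lp.memLp f), Lp.toLp_coeFn]

end Inner

/-- Translation by `s` in time. -/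
def timeShift (s : ℝ) (p : Pt N) : Pt N := (p.1, s + p.2)

lemma measurePreserving_timeShift (s : ℝ) :
    MeasurePreserving (timeShift s : Pt N → Pt N) volume volume :=
  (MeasurePreserving.id volume).prod (measurePreserving_add_left volume s)

lemma continuous_uncurry_timeShift :
    Continuous (Function.uncurry (timeShift : ℝ → Pt N → Pt N)) := by
  unfold timeShift Function.uncurry
  fun_prop

section Shift

variable {E : Type*} [NormedAddCommGroup E]

lemma memLp_timeShift {F : Pt N → E} (hF : MemLp F 2 volume) (s : ℝ) :
    MemLp (fun p => F (timeShift s p)) 2 volume :=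
  hF.comp_measurePreserving (measurePreserving_timeShift s)

lemma continuous_toLp_timeShift {F : Pt N → E} (hF : MemLp F 2 volume) :
    Continuous fun s => (memLp_timeShift hF s).toLp _ := by
  have h : Continuous fun s : ℝ =>
      (⟨timeShift s, continuous_uncurry_timeShift.comp (Continuous.prodMk_right s)⟩ :
        C(Pt N, Pt N)) :=
    ContinuousMap.continuous_of_continuous_uncurry _ continuous_uncurry_timeShift
  exact (continuous_const (y := hF.toLp F)).compMeasurePreservingLp h
    (fun s => measurePreserving_timeShift s) (by norm_num)

variable [InnerProductSpace ℝ E]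

/-- This follows from strong continuity of translations in L². Joint continuity in two independent
shifts is needed because in the energy argument one factor is averaged over its shift while the
other is shifted by the full step. -/
lemma continuous_setIntegral_inner_timeShift {F K : Pt N → E} (hF : MemLp F 2 volume)
    (hK : MemLp K 2 volume) (S : Set (Pt N)) :
    Continuous fun q : ℝ × ℝ =>
      ∫ p in S, inner ℝ (F (timeShift q.1 p)) (K (timeShift q.2 p)) := by
  let R := LpToLpRestrictCLM (Pt N) E ℝ volume 2 S
  have h : (fun q : ℝ × ℝ => ∫ p in S, inner ℝ (F (timeShift q.1 p)) (K (timeShift q.2 p))) =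
      fun q => inner ℝ (R ((memLp_timeShift hF q.1).toLp _))
        (R ((memLp_timeShift hK q.2).toLp _)) := by
    funext q
    rw [L2.inner_def]
    refine integral_congr_ae ?_
    filter_upwards [LpToLpRestrictCLM_coeFn ℝ S ((memLp_timeShift hF q.1).toLp _),
      LpToLpRestrictCLM_coeFn ℝ S ((memLp_timeShift hK q.2).toLp _),
      ae_restrict_of_ae (memLp_timeShift hF q.1).coeFn_toLp,
      ae_restrict_of_ae (memLp_timeShift hK q.2).coeFn_toLp] with p a b c d
    rw [a, b, c, d]
  rw [h]
  exact (R.continuous.comp ((continuous_toLp_timeShift hF).comp continuous_fst)).inner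
    (R.continuous.comp ((continuous_toLp_timeShift hK).comp continuous_snd))

/-- The shear (s, p) ↦ (s, p shifted by s) preserves the product measure, so both factors are square
integrable on the product with the finite measure `ν`. -/
lemma integrable_inner_timeShift {F K : Pt N → E} (hF : MemLp F 2 volume)
    (hK : MemLp K 2 volume) (ν : Measure ℝ) [IsFiniteMeasure ν] :
    Integrable (fun q : ℝ × Pt N => inner ℝ (F (timeShift q.1 q.2)) (K q.2))
      (ν.prod volume) := by
  have h : MeasurePreserving (fun q : ℝ × Pt N => (q.1, timeShift q.1 q.2))
      (ν.prod volume) (ν.prod volume) :=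
    (MeasurePreserving.id ν).skew_product continuous_uncurry_timeShift.measurable
      (ae_of_all _ fun s => (measurePreserving_timeShift s).map_eq)
  exact integrable_inner_of_memLp ((hF.comp_snd ν).comp_measurePreserving h) (hK.comp_snd ν)

end Shift

/-- The parameter of `J` is also the length of the averaging interval, so continuity in `s` alone
would not do: all points (s, h) with 0 < s ≤ h must be close to the origin at once. -/
lemma tendsto_average_diagonal {J : ℝ × ℝ → ℝ} (hJ : Continuous J) :
    Tendsto (fun h => h⁻¹ * ∫ s in (0 : ℝ)..h, J (s, h)) (𝓝[>] 0) (𝓝 (J (0, 0))) := by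
  rw [Metric.tendsto_nhds]
  intro ε hε
  obtain ⟨δ, hδ, h⟩ := Metric.continuousAt_iff.1 (hJ.continuousAt (x := (0, 0))) (ε / 2)
    (half_pos hε)
  filter_upwards [Ioo_mem_nhdsGT hδ] with η hη
  have hc : Continuous fun s => J (s, η) := hJ.comp (by fun_prop)
  have e : η⁻¹ * (∫ s in (0 : ℝ)..η, J (s, η)) - J (0, 0) =
      η⁻¹ * ∫ s in (0 : ℝ)..η, (J (s, η) - J (0, 0)) := by
    rw [intervalIntegral.integral_sub (hc.intervalIntegrable _ _) (by simp)]
    have := hη.1.ne'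
    simp
    field_simp
  rw [Real.dist_eq, e, abs_mul, abs_of_pos (inv_pos.2 hη.1)]
  have hb := intervalIntegral.norm_integral_le_of_norm_le_const (a := 0) (b := η)
    (f := fun s => J (s, η) - J (0, 0)) (C := ε / 2) fun s hs => by
      rw [uIoc_of_le hη.1.le] at hs
      have := h (x := (s, η)) (by
        rw [Prod.dist_eq, Real.dist_eq, Real.dist_eq, sub_zero, sub_zero, abs_of_pos hs.1,
          abs_of_pos hη.1]
        exact max_lt (hs.2.trans_lt hη.2) hη.2)
      exact this.le
  rw [sub_zero, abs_of_pos hη.1, Real.norm_eq_abs] at hb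
  calc _ ≤ η⁻¹ * (ε / 2 * η) := by gcongr; exact inv_nonneg.2 hη.1.le
    _ = ε / 2 := by have := hη.1.ne'; field_simp
    _ < ε := half_lt_self hε

/-! ### The energy identity -/

section Energy

variable {E : Type*} [NormedAddCommGroup E] [InnerProductSpace ℝ E]

lemma integrableOn_intervalIntegral_timeShift {A K : Pt N → E} (hA : MemLp A 2 volume)
    (hK : MemLp K 2 volume) {h : ℝ} (hh : 0 ≤ h) (τ : ℝ) :
    IntegrableOn (fun t => ∫ s in (0 : ℝ)..h, ∫ x, inner ℝ (A (timeShift s (x, t))) (K (x, t)))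
        (Ioi τ) ∧
      ∫ t in Ioi τ, ∫ s in (0 : ℝ)..h, ∫ x, inner ℝ (A (timeShift s (x, t))) (K (x, t)) =
        ∫ s in (0 : ℝ)..h, ∫ p in univ ×ˢ Ioi τ, inner ℝ (A (timeShift s p)) (K p) := by
  have i0 := integrable_inner_timeShift hA hK (volume.restrict (Ioc 0 h))
  have i1 : Integrable (fun q : ℝ × EuclideanSpace ℝ (Fin N) × ℝ =>
      inner ℝ (A (timeShift q.1 q.2)) (K q.2))
      ((volume.restrict (Ioc 0 h)).prod (volume.prod (volume.restrict (Ioi τ)))) := by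
    refine i0.mono_measure (Measure.prod_mono le_rfl ?_)
    exact Measure.prod_mono le_rfl Measure.restrict_le_self
  have hm : MeasurePreserving
      (fun q : (ℝ × ℝ) × EuclideanSpace ℝ (Fin N) => ((q.1.1, (q.2, q.1.2)) :
        ℝ × EuclideanSpace ℝ (Fin N) × ℝ))
      (((volume.restrict (Ioc 0 h)).prod (volume.restrict (Ioi τ))).prod volume)
      ((volume.restrict (Ioc 0 h)).prod (volume.prod (volume.restrict (Ioi τ)))) :=
    ((MeasurePreserving.id _).prod Measure.measurePreserving_swap).comp
      (measurePreserving_prodAssoc _ _ _)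
  have i2 := hm.integrable_comp_of_integrable i1
  have i3 := i2.integral_prod_left
  have hS : ∀ f : Pt N → ℝ, ∫ p in univ ×ˢ Ioi τ, f p =
      ∫ p, f p ∂((volume : Measure (EuclideanSpace ℝ (Fin N))).prod (volume.restrict (Ioi τ))) := by
    intro f
    rw [Measure.volume_eq_prod, ← Measure.prod_restrict, Measure.restrict_univ]
  have i4 := i3.swap.integral_prod_left
  have e := integral_integral_swap (f := fun s t => ∫ x, inner ℝ (A (timeShift s (x, t)))
    (K (x, t))) i3
  simp only [intervalIntegral.integral_of_le hh]
  refine ⟨i4, e.symm.trans (integral_congr_ae ?_)⟩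
  filter_upwards [i1.prod_right_ae] with s hs
  rw [hS, integral_prod_symm _ hs]

/-- Translation moves the window of integration by `h`. The two integrals cancel on the overlap,
nothing is left beyond `T`, and only the initial layer from τ to h + τ survives. -/
lemma integral_norm_sq_diff {H : Type*} [NormedAddCommGroup H] {Z : ℝ → H} {T : ℝ}
    (hZ : ContinuousOn Z (Ici 0)) (hZT : ∀ t, T ≤ t → Z t = 0) {τ h : ℝ} (hτ : 0 ≤ τ) (hh : 0 < h) :
    ∫ t in Ioi τ, (‖Z (h + t)‖ ^ 2 - ‖Z t‖ ^ 2) = -∫ t in τ..h + τ, ‖Z t‖ ^ 2 := by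
  set R := max T τ
  have hc : ContinuousOn (fun t => ‖Z t‖ ^ 2) (Ici 0) := hZ.norm.pow 2
  have hi : ∀ a b, 0 ≤ a → 0 ≤ b → IntervalIntegrable (fun t => ‖Z t‖ ^ 2) volume a b :=
    fun a b ha hb => (hc.mono fun t ht => (le_min ha hb).trans ht.1).intervalIntegrable
  have hR : 0 ≤ R := hτ.trans (le_max_right _ _)
  have e1 : ∫ t in Ioi τ, (‖Z (h + t)‖ ^ 2 - ‖Z t‖ ^ 2) =
      ∫ t in τ..R, (‖Z (h + t)‖ ^ 2 - ‖Z t‖ ^ 2) := by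
    rw [intervalIntegral.integral_of_le (le_max_right _ _)]
    refine setIntegral_eq_of_subset_of_forall_sdiff_eq_zero measurableSet_Ioi
      Ioc_subset_Ioi_self fun t ht => ?_
    have h1 : R < t := by
      by_contra h2
      exact ht.2 ⟨ht.1, not_lt.1 h2⟩
    have h2 : T ≤ t := (le_max_left _ _).trans h1.le
    simp [hZT t h2, hZT (h + t) (by linarith)]
  have hi' : IntervalIntegrable (fun t => ‖Z (h + t)‖ ^ 2) volume τ R := by
    have hc' : ContinuousOn (fun t => ‖Z (h + t)‖ ^ 2) (uIcc τ R) :=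
      hc.comp (by fun_prop) fun t ht => by
        have : τ ≤ t := (le_min le_rfl (le_max_right _ _)).trans ht.1
        exact mem_Ici.2 (by linarith)
    exact hc'.intervalIntegrable
  have e2 : ∫ t in R..h + R, ‖Z t‖ ^ 2 = 0 := by
    refine (intervalIntegral.integral_congr fun t ht => ?_).trans intervalIntegral.integral_zero
    rw [uIcc_of_le (by linarith)] at ht
    simp [hZT t ((le_max_left _ _).trans ht.1)]
  rw [e1, intervalIntegral.integral_sub hi' (hi _ _ hτ hR),
    intervalIntegral.integral_comp_add_left (fun t => ‖Z t‖ ^ 2)]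
  have a1 := intervalIntegral.integral_add_adjacent_intervals (hi τ (h + τ) hτ (by linarith))
    (hi (h + τ) (h + R) (by linarith) (by linarith))
  have a2 := intervalIntegral.integral_add_adjacent_intervals (hi τ R hτ hR)
    (hi R (h + R) hR (by linarith))
  linarith

/-- The energy identity in abstract form. The hypothesis `hw` pairs an increment of `Z` with the
value of `Z` at an unrelated time t, so it can be used at both ends of a time step. -/
theorem norm_sq_eq_of_weak_equation {H : Type*} [NormedAddCommGroup H] [InnerProductSpace ℝ H]
    {Z : ℝ → H} {T : ℝ} (hZ : ContinuousOn Z (Ici 0))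
    (hZT : ∀ t, T ≤ t → Z t = 0) {A G : Pt N → E} (hA : MemLp A 2 volume)
    (hG : MemLp G 2 volume)
    (hw : ∀ᵐ t : ℝ, 0 < t → ∀ a b, 0 ≤ a → a ≤ b →
      inner ℝ (Z t) (Z b - Z a) = ∫ s in a..b, ∫ x, inner ℝ (A (x, s)) (G (x, t)))
    {τ : ℝ} (hτ : 0 ≤ τ) :
    ‖Z τ‖ ^ 2 = -2 * ∫ p in univ ×ˢ Ioi τ, inner ℝ (A p) (G p) := by
  set J₁ : ℝ × ℝ → ℝ := fun q =>
    ∫ p in univ ×ˢ Ioi τ, inner ℝ (A (timeShift q.1 p)) (G (timeShift q.2 p)) with hJ₁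
  have cJ₁ : Continuous J₁ := continuous_setIntegral_inner_timeShift hA hG _
  have z0 : ∀ p : Pt N, timeShift 0 p = p := fun p => by simp [timeShift]
  -- The identity before division by `h`: `hw` is taken at the times t and h + t, for the increment
  -- from t to h + t, and integrated over t > τ.
  have key : ∀ h : ℝ, 0 < h → -∫ t in τ..h + τ, ‖Z t‖ ^ 2 =
      ∫ s in (0 : ℝ)..h, (J₁ (s, h) + J₁ (s, 0)) := by
    intro h hh
    obtain ⟨f1, f2⟩ := integrableOn_intervalIntegral_timeShift hA (memLp_timeShift hG h) hh.le τ
    obtain ⟨g1, g2⟩ := integrableOn_intervalIntegral_timeShift hA hG hh.le τ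
    have c1 : Continuous fun s => J₁ (s, h) := cJ₁.comp (by fun_prop)
    have c2 : Continuous fun s => J₁ (s, 0) := cJ₁.comp (by fun_prop)
    rw [← integral_norm_sq_diff hZ hZT hτ hh, intervalIntegral.integral_add
      (c1.intervalIntegrable _ _) (c2.intervalIntegrable _ _)]
    simp only [hJ₁, z0]
    rw [← f2, ← g2, ← integral_add f1 g1]
    refine integral_congr_ae ?_
    have hw' : ∀ᵐ t : ℝ, 0 < h + t → ∀ a b, 0 ≤ a → a ≤ b →
        inner ℝ (Z (h + t)) (Z b - Z a) =
          ∫ s in a..b, ∫ x, inner ℝ (A (x, s)) (G (x, h + t)) :=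
      (measurePreserving_add_left volume h).quasiMeasurePreserving.ae hw
    filter_upwards [ae_restrict_of_ae hw, ae_restrict_of_ae hw',
      ae_restrict_mem measurableSet_Ioi] with t a b ht
    have ht0 : 0 < t := hτ.trans_lt ht
    have a' := a ht0 t (h + t) ht0.le (by linarith)
    have b' := b (by linarith) t (h + t) ht0.le (by linarith)
    have s1 := intervalIntegral.integral_comp_add_right (a := 0) (b := h)
      (fun s => ∫ x, inner ℝ (A (x, s)) (G (x, t))) t
    have s2 := intervalIntegral.integral_comp_add_right (a := 0) (b := h)
      (fun s => ∫ x, inner ℝ (A (x, s)) (G (x, h + t))) t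
    rw [zero_add] at s1 s2
    rw [← s1] at a'
    rw [← s2] at b'
    simp only [timeShift]
    -- The symmetrized difference ‖Z(h+t)‖² - ‖Z(t)‖² = ⟨Z(h+t) + Z(t), Z(h+t) - Z(t)⟩ is exact, so
    -- no remainder quadratic in the increment has to be controlled.
    rw [← a', ← b', ← inner_add_left, ← real_inner_self_eq_norm_sq, ← real_inner_self_eq_norm_sq]
    simp only [inner_add_left, inner_sub_right]
    rw [real_inner_comm (Z t) (Z (h + t))]
    ring
  have l1 := tendsto_average_diagonal (J := fun q => J₁ q + J₁ (q.1, 0))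
    (cJ₁.add (cJ₁.comp (by fun_prop)))
  have l2 : Tendsto (fun h => h⁻¹ * -∫ t in τ..h + τ, ‖Z t‖ ^ 2) (𝓝[>] 0) (𝓝 (-‖Z τ‖ ^ 2)) := by
    -- Freezing `Z` at negative times gives a globally continuous function, as
    -- `tendsto_average_diagonal` requires.
    set Z' : ℝ → ℝ := fun t => ‖Z (max 0 t)‖ ^ 2
    have hc : Continuous Z' := by
      have : Continuous fun t => Z (max 0 t) :=
        hZ.comp_continuous (by fun_prop) fun t => mem_Ici.2 (le_max_left _ _)
      exact this.norm.pow 2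
    have := tendsto_average_diagonal (J := fun q => -Z' (q.1 + τ)) (by fun_prop)
    have e0 : -Z' (((0 : ℝ), (0 : ℝ)).1 + τ) = -‖Z τ‖ ^ 2 := by simp [Z', hτ]
    rw [e0] at this
    refine this.congr' ?_
    filter_upwards [self_mem_nhdsWithin] with h hh
    rw [intervalIntegral.integral_neg, intervalIntegral.integral_comp_add_right, zero_add]
    congr 2
    refine intervalIntegral.integral_congr fun t ht => ?_
    have hh' : 0 < h := hh
    rw [uIcc_of_le (by linarith)] at ht
    simp [Z', hτ.trans ht.1]
  have l3 : Tendsto (fun h => h⁻¹ * -∫ t in τ..h + τ, ‖Z t‖ ^ 2) (𝓝[>] 0)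
      (𝓝 (J₁ (0, 0) + J₁ (0, 0))) := by
    refine l1.congr' ?_
    filter_upwards [self_mem_nhdsWithin] with h hh
    rw [key h hh]
  have := tendsto_nhds_unique l2 l3
  simp only [hJ₁, z0] at this
  linarith

end Energy

/-! ### The fundamental theorem of calculus for weak derivatives in time -/

/-- The primitive vanishes to the left of the support of `χ`, and to the right of it because the
integral of `χ` is zero. Its support thus lies between the extreme points of the compact set
`tsupport χ`, which are inside the open interval. -/
lemma exists_primitive_tsupport_subset {T : ℝ} {χ : ℝ → ℝ} (h1 : ContDiff ℝ (⊤ : ℕ∞) χ)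
    (h2 : HasCompactSupport χ) (h3 : tsupport χ ⊆ Ioo 0 T) (h4 : ∫ t in (0 : ℝ)..T, χ t = 0) :
    ∃ ψ : ℝ → ℝ, ContDiff ℝ (⊤ : ℕ∞) ψ ∧ HasCompactSupport ψ ∧ tsupport ψ ⊆ Ioo 0 T ∧
      deriv ψ = χ := by
  rcases (tsupport χ).eq_empty_or_nonempty with h0 | hne
  · have : χ = 0 := by
      rwa [tsupport_eq_empty_iff] at h0
    exact ⟨0, contDiff_const, HasCompactSupport.zero, by simp [tsupport], by
      subst this; funext t; exact deriv_const t 0⟩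
  obtain ⟨a, ha, ha'⟩ := h2.isCompact.exists_isLeast hne
  obtain ⟨b, hb, hb'⟩ := h2.isCompact.exists_isGreatest hne
  have za : ∀ t, t < a → χ t = 0 := fun t ht =>
    image_eq_zero_of_notMem_tsupport fun h => absurd (ha' h) (not_le.2 ht)
  have zb : ∀ t, b < t → χ t = 0 := fun t ht =>
    image_eq_zero_of_notMem_tsupport fun h => absurd (hb' h) (not_le.2 ht)
  have hd : ∀ t, HasDerivAt (fun t => ∫ s in (0 : ℝ)..t, χ s) (χ t) t := fun t =>
    (h1.continuous.integral_hasStrictDerivAt 0 t).hasDerivAt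
  have hsub : tsupport (fun t => ∫ s in (0 : ℝ)..t, χ s) ⊆ Icc a b := by
    refine closure_minimal (fun t ht => ?_) isClosed_Icc
    by_contra hn
    refine ht ?_
    rw [mem_Icc, not_and_or, not_le, not_le] at hn
    rcases hn with hn | hn
    · refine (intervalIntegral.integral_congr fun s hs => ?_).trans intervalIntegral.integral_zero
      exact za s (hs.2.trans_lt (max_lt (h3 ha).1 hn))
    · change ∫ s in (0 : ℝ)..t, χ s = 0
      rw [← intervalIntegral.integral_add_adjacent_intervals
        (h1.continuous.intervalIntegrable 0 T) (h1.continuous.intervalIntegrable T t), h4, zero_add]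
      refine (intervalIntegral.integral_congr fun s hs => ?_).trans intervalIntegral.integral_zero
      exact zb s ((lt_min (h3 hb).2 hn).trans_le hs.1)
  refine ⟨_, ?_, HasCompactSupport.of_support_subset_isCompact isCompact_Icc
    ((subset_tsupport _).trans hsub), hsub.trans fun t ht =>
      ⟨(h3 ha).1.trans_le ht.1, ht.2.trans_lt (h3 hb).2⟩, funext fun t => (hd t).deriv⟩
  rw [contDiff_infty_iff_deriv]
  refine ⟨fun t => (hd t).differentiableAt, ?_⟩
  rw [funext fun t => (hd t).deriv]
  exact h1

/-- The du Bois-Reymond argument: subtracting from χ its integral times a fixed bump χ₀ of mass one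
leaves the derivative of a test function. Hence D - κ, with κ = ∫ D χ₀, annihilates every χ;
continuity turns almost everywhere into everywhere, end points included. -/
lemma exists_eq_const_of_weak_deriv_eq_zero {T : ℝ} (hT : 0 < T) {D : ℝ → ℝ}
    (hD : ContinuousOn D (Icc 0 T))
    (h : ∀ ψ : ℝ → ℝ, ContDiff ℝ (⊤ : ℕ∞) ψ → HasCompactSupport ψ → tsupport ψ ⊆ Ioo 0 T →
      ∫ t in (0 : ℝ)..T, D t * deriv ψ t = 0) :
    ∃ κ, ∀ t ∈ Icc 0 T, D t = κ := by
  let f : ContDiffBump (T / 2) := ⟨T / 8, T / 4, by positivity, by linarith⟩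
  set χ₀ := f.normed volume
  have c₀ : ContDiff ℝ (⊤ : ℕ∞) χ₀ := f.contDiff_normed
  have s₀ : HasCompactSupport χ₀ := f.hasCompactSupport_normed
  have t₀ : tsupport χ₀ ⊆ Ioo 0 T := by
    rw [f.tsupport_normed_eq, Real.closedBall_eq_Icc]
    intro t ht
    constructor <;> [have := ht.1; have := ht.2] <;> dsimp [f] at this <;> linarith
  have hint : ∀ k : ℝ → ℝ, tsupport k ⊆ Ioo 0 T → ∫ t in (0 : ℝ)..T, k t = ∫ t, k t := by
    intro k hk
    rw [intervalIntegral.integral_of_le hT.le]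
    exact setIntegral_eq_integral_of_forall_compl_eq_zero fun t ht =>
      image_eq_zero_of_notMem_tsupport fun h' => ht (Ioo_subset_Ioc_self (hk h'))
  have i₀ : ∫ t in (0 : ℝ)..T, χ₀ t = 1 := by rw [hint _ t₀]; exact f.integral_normed
  have hDi : ∀ k : ℝ → ℝ, Continuous k → IntervalIntegrable (fun t => D t * k t) volume 0 T :=
    fun k hk => by
      refine ContinuousOn.intervalIntegrable ?_
      rw [uIcc_of_le hT.le]
      exact hD.mul hk.continuousOn
  set κ := ∫ t in (0 : ℝ)..T, D t * χ₀ t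
  refine ⟨κ, ?_⟩
  have hz : ∀ᵐ t, t ∈ Ioo 0 T → D t - κ = 0 := by
    refine isOpen_Ioo.ae_eq_zero_of_integral_contDiff_smul_eq_zero
      ((hD.mono Ioo_subset_Icc_self).sub continuousOn_const |>.locallyIntegrableOn
        measurableSet_Ioo) fun χ h1 h2 h3 => ?_
    set I := ∫ t in (0 : ℝ)..T, χ t
    have hsupp : tsupport (fun t => χ t - I * χ₀ t) ⊆ Ioo 0 T :=
      (tsupport_sub χ fun t => I * χ₀ t).trans
        (union_subset h3 ((tsupport_mul_subset_right (f := fun _ => I)).trans t₀))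
    obtain ⟨ψ, p1, p2, p3, p4⟩ := exists_primitive_tsupport_subset (T := T)
      (χ := fun t => χ t - I * χ₀ t) (h1.sub (contDiff_const.mul c₀))
      (h2.sub (s₀.mul_left (f := fun _ => I))) hsupp (by
        rw [intervalIntegral.integral_sub (h1.continuous.intervalIntegrable _ _)
          ((c₀.continuous.intervalIntegrable _ _).const_mul I),
          intervalIntegral.integral_const_mul, i₀]
        simp [I])
    have e := h ψ p1 p2 p3
    rw [p4] at e
    have e' : ∫ t in (0 : ℝ)..T, (D t * χ t - I * (D t * χ₀ t)) = 0 := by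
      refine (intervalIntegral.integral_congr fun t _ => ?_).trans e
      ring
    rw [intervalIntegral.integral_sub (hDi _ h1.continuous)
      ((hDi _ c₀.continuous).const_mul I), intervalIntegral.integral_const_mul] at e'
    rw [← hint _ ((tsupport_smul_subset_left χ fun t => D t - κ).trans h3)]
    have e2 : ∫ t in (0 : ℝ)..T, χ t • (D t - κ) = ∫ t in (0 : ℝ)..T, (D t * χ t - κ * χ t) :=
      intervalIntegral.integral_congr fun t _ => by simp only [smul_eq_mul]; ring
    rw [e2, intervalIntegral.integral_sub (hDi _ h1.continuous)
      ((h1.continuous.intervalIntegrable _ _).const_mul κ), intervalIntegral.integral_const_mul]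
    linarith [mul_comm I κ]
  have hz' : D =ᵐ[volume.restrict (Icc 0 T)] fun _ => κ := by
    rw [← restrict_Ioo_eq_restrict_Icc]
    refine (ae_restrict_iff' measurableSet_Ioo).2 ?_
    filter_upwards [hz] with t ht h'
    exact sub_eq_zero.1 (ht h')
  exact fun t ht => Measure.eqOn_Icc_of_ae_eq volume hT.ne hz' hD continuousOn_const ht

/-- The primitive of `B` is only absolutely continuous, so integration by parts is used in that
class. It shows that `m` minus the primitive has zero weak derivative, hence is constant on the
closed interval. -/
lemma sub_eq_integral_of_weak_deriv {T : ℝ} (hT : 0 < T) {m B : ℝ → ℝ}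
    (hm : ContinuousOn m (Icc 0 T)) (hB : IntegrableOn B (Ioo 0 T))
    (h : ∀ ψ : ℝ → ℝ, ContDiff ℝ (⊤ : ℕ∞) ψ → HasCompactSupport ψ → tsupport ψ ⊆ Ioo 0 T →
      ∫ t in Ioo 0 T, (m t * deriv ψ t + B t * ψ t) = 0) {a b : ℝ} (ha : a ∈ Icc 0 T)
    (hb : b ∈ Icc 0 T) : m b - m a = ∫ t in a..b, B t := by
  have hBi : IntervalIntegrable B volume 0 T := by
    rw [intervalIntegrable_iff_integrableOn_Ioo_of_le hT.le]
    exact hB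
  have hM := hBi.absolutelyContinuousOnInterval_intervalIntegral (c := 0) left_mem_uIcc
  have hMc := hM.continuousOn
  rw [uIcc_of_le hT.le] at hMc
  obtain ⟨κ, hκ⟩ := exists_eq_const_of_weak_deriv_eq_zero hT (hm.sub hMc) fun ψ p1 p2 p3 => by
    have hψ : AbsolutelyContinuousOnInterval ψ 0 T :=
      ((p1.of_le (by exact_mod_cast le_top)).contDiffOn (n := 1)).absolutelyContinuousOnInterval
    have e := hM.integral_mul_deriv_eq_deriv_mul hψ
    have hd : Continuous (deriv ψ) := p1.continuous_deriv (by simp)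
    have e2 : ∫ t in (0 : ℝ)..T, deriv (fun x => ∫ v in (0 : ℝ)..x, B v) t * ψ t =
        ∫ t in (0 : ℝ)..T, B t * ψ t := by
      refine intervalIntegral.integral_congr_ae ?_
      filter_upwards [hBi.ae_hasDerivAt_integral] with t ht ht'
      rw [(ht (uIoc_subset_uIcc ht') 0 left_mem_uIcc).deriv]
    have v0 : ψ 0 = 0 := image_eq_zero_of_notMem_tsupport fun h' => absurd (p3 h').1 (lt_irrefl _)
    have vT : ψ T = 0 := image_eq_zero_of_notMem_tsupport fun h' => absurd (p3 h').2 (lt_irrefl _)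
    rw [e2, v0, vT] at e
    have e3 := h ψ p1 p2 p3
    rw [← integral_Ioc_eq_integral_Ioo, ← intervalIntegral.integral_of_le hT.le] at e3
    have im : IntervalIntegrable (fun t => m t * deriv ψ t) volume 0 T := by
      refine ContinuousOn.intervalIntegrable ?_
      rw [uIcc_of_le hT.le]
      exact hm.mul hd.continuousOn
    have iM : IntervalIntegrable (fun t => (∫ v in (0 : ℝ)..t, B v) * deriv ψ t) volume 0 T := by
      refine ContinuousOn.intervalIntegrable ?_
      rw [uIcc_of_le hT.le]
      exact hMc.mul hd.continuousOn
    rw [intervalIntegral.integral_add im (hBi.mul_continuousOn p1.continuous.continuousOn)] at e3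
    simp only [Pi.sub_apply, sub_mul]
    rw [intervalIntegral.integral_sub im iM, e]
    linarith
  have sub : ∀ t ∈ Icc 0 T, IntervalIntegrable B volume 0 t := fun t ht =>
    hBi.mono_set (by rw [uIcc_of_le hT.le, uIcc_of_le ht.1]; exact Icc_subset_Icc_right ht.2)
  rw [← intervalIntegral.integral_interval_sub_left (sub b hb) (sub a ha)]
  have h1 := hκ a ha
  have h2 := hκ b hb
  simp only [Pi.sub_apply] at h1 h2
  linarith

/-! ### The equation at fixed times -/

section TensorTest

variable {φ : EuclideanSpace ℝ (Fin N) → ℝ} {ψ : ℝ → ℝ}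

lemma fderiv_tensor (hφ : Differentiable ℝ φ) (hψ : Differentiable ℝ ψ) (p : Pt N) (v : Pt N) :
    fderiv ℝ (fun p : Pt N => φ p.1 * ψ p.2) p v =
      φ p.1 * (v.2 * deriv ψ p.2) + ψ p.2 * fderiv ℝ φ p.1 v.1 := by
  have h1 : HasFDerivAt (fun p : Pt N => φ p.1)
      ((fderiv ℝ φ p.1).comp (ContinuousLinearMap.fst ℝ _ _)) p :=
    (hφ p.1).hasFDerivAt.comp p hasFDerivAt_fst
  have h2 : HasFDerivAt (fun p : Pt N => ψ p.2)
      ((fderiv ℝ ψ p.2).comp (ContinuousLinearMap.snd ℝ _ _)) p :=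
    (hψ p.2).hasFDerivAt.comp p hasFDerivAt_snd
  rw [(h1.fun_mul h2).fderiv]
  have : fderiv ℝ ψ p.2 v.2 = v.2 * deriv ψ p.2 := by
    rw [fderiv_eq_smul_deriv, smul_eq_mul]
  simp [this]

lemma isTest_tensor {P : Problem N} (h1 : ContDiff ℝ (⊤ : ℕ∞) φ) (h2 : HasCompactSupport φ)
    (h3 : tsupport φ ⊆ P.Ω) (k1 : ContDiff ℝ (⊤ : ℕ∞) ψ) (k2 : HasCompactSupport ψ)
    (k3 : tsupport ψ ⊆ Ioo 0 P.T) : IsTest P fun p => φ p.1 * ψ p.2 := by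
  have hs : tsupport (fun p : Pt N => φ p.1 * ψ p.2) ⊆ tsupport φ ×ˢ tsupport ψ := by
    refine closure_minimal (fun p hp => ?_)
      ((isClosed_tsupport φ).prod (isClosed_tsupport ψ))
    exact ⟨subset_tsupport _ (left_ne_zero_of_mul hp), subset_tsupport _ (right_ne_zero_of_mul hp)⟩
  refine ⟨(h1.comp contDiff_fst).mul (k1.comp contDiff_snd),
    HasCompactSupport.of_support_subset_isCompact (h2.isCompact.prod k2.isCompact)
      ((subset_tsupport _).trans hs), hs.trans (prod_mono h3 k3)⟩

end TensorTest

lemma inner_gradient_eq_sum (φ : EuclideanSpace ℝ (Fin N) → ℝ) (x v : EuclideanSpace ℝ (Fin N)) :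
    inner ℝ v (gradient φ x) = ∑ i, v i * fderiv ℝ φ x (EuclideanSpace.single i 1) := by
  rw [real_inner_comm, inner_gradient_left]
  conv_lhs => rw [← (EuclideanSpace.basisFun (Fin N) ℝ).sum_repr v]
  simp

section FstPairing

variable {E : Type*} [NormedAddCommGroup E] [InnerProductSpace ℝ E]
  {X Y : Type*} [MeasurableSpace X] [MeasurableSpace Y] {μ : Measure X} {ν : Measure Y}
  [IsFiniteMeasure ν]

lemma integral_norm_sq_comp_fst [SFinite μ] (k : Lp E 2 μ) :
    ∫ p, ‖k p.1‖ ^ 2 ∂(μ.prod ν) = ν.real univ * ‖k‖ ^ 2 := by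
  have h : Integrable (fun p : X × Y => ‖k p.1‖ ^ 2) (μ.prod ν) :=
    ((Lp.memLp k).comp_fst ν).integrable_norm_pow (p := 2) (by norm_num)
  rw [integral_prod _ h, norm_Lp_sq, ← integral_const_mul]
  simp

/-- Regarding `k` as constant in the second variable multiplies its norm by the square root of the
total mass of `ν`. This continuity is what lets the weak equation pass from smooth functions to
H¹₀(Ω). -/
lemma continuous_integral_inner_comp_fst [SFinite μ] {A : X × Y → E} (hA : MemLp A 2 (μ.prod ν)) :
    Continuous fun k : Lp E 2 μ => ∫ p, inner ℝ (A p) (k p.1) ∂(μ.prod ν) := by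
  let F : Lp E 2 μ →ₗ[ℝ] Lp E 2 (μ.prod ν) :=
    { toFun := fun k => ((Lp.memLp k).comp_fst ν).toLp _
      map_add' := fun k l => by
        rw [← MemLp.toLp_add]
        refine MemLp.toLp_congr _ _ ?_
        exact Measure.quasiMeasurePreserving_fst.ae (Lp.coeFn_add k l)
      map_smul' := fun a k => by
        rw [RingHom.id_apply, ← MemLp.toLp_const_smul]
        refine MemLp.toLp_congr _ _ ?_
        exact Measure.quasiMeasurePreserving_fst.ae (Lp.coeFn_smul a k) }
  have hF : Continuous F := by
    refine (F.mkContinuous (√(ν.real univ)) fun k => ?_).continuous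
    refine le_of_sq_le_sq ?_ (by positivity)
    rw [mul_pow, Real.sq_sqrt measureReal_nonneg, ← integral_norm_sq_comp_fst]
    exact (norm_toLp_sq ((Lp.memLp k).comp_fst ν)).le
  have : (fun k : Lp E 2 μ => ∫ p, inner ℝ (A p) (k p.1) ∂(μ.prod ν)) =
      fun k => inner ℝ (hA.toLp A) (F k) := by
    funext k
    exact (inner_toLp hA ((Lp.memLp k).comp_fst ν)).symm
  rw [this]
  exact continuous_const.inner hF

end FstPairing

lemma setIntegral_QT_eq (P : Problem N) {F : Pt N → ℝ} (hF : IntegrableOn F P.QT) :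
    ∫ p in P.QT, F p = ∫ t in Ioo 0 P.T, ∫ x in P.Ω, F (x, t) := by
  change ∫ p, F p ∂P.μQ = _
  have hF' : Integrable F P.μQ := hF
  rw [μQ_eq_prod] at hF' ⊢
  exact integral_prod_symm _ hF'

/-- `u` solves `u_t = -∇ · A + f` in the sense of distributions on `Q_T`. -/
def IsWeakSolution (P : Problem N) (u : Pt N → ℝ) (A : Pt N → EuclideanSpace ℝ (Fin N))
    (f : Pt N → ℝ) : Prop :=
  ∀ φ : Pt N → ℝ, IsTest P φ →
    ∫ p in P.QT, (u p * dt φ p + (∑ i, A p i * dx i φ p) + f p * φ p) = 0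

section FixedTime

variable {P : Problem N} {u : Pt N → ℝ} {z : ℝ → Lp ℝ 2 P.μΩ}
  {A : Pt N → EuclideanSpace ℝ (Fin N)} {f : Pt N → ℝ}

lemma integrable_pairing (hA : MemLp A 2 P.μQ) (hf : MemLp f 2 P.μQ)
    {γ : EuclideanSpace ℝ (Fin N) → EuclideanSpace ℝ (Fin N)} {v : EuclideanSpace ℝ (Fin N) → ℝ}
    (hγ : MemLp γ 2 P.μΩ) (hv : MemLp v 2 P.μΩ) :
    Integrable (fun p => inner ℝ (A p) (γ p.1) + f p * v p.1) P.μQ := by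
  have h1 := hγ.comp_fst (volume.restrict (Ioo 0 P.T))
  have h2 := hv.comp_fst (volume.restrict (Ioo 0 P.T))
  rw [← μQ_eq_prod] at h1 h2
  exact (integrable_inner_of_memLp hA h1).add (hf.integrable_mul h2)

/-- Testing with products φ(x)ψ(t) says that ⟨φ, z(t)⟩ has the weak derivative ∫ (A·∇φ + fφ) on (0,
T). As it is continuous on [0, T], the fundamental theorem of calculus holds up to the end points.
-/
lemma inner_sub_eq_of_mem_testGraph (hu : MemLp u 2 P.μQ) (hz : ContinuousOn z (Icc 0 P.T))
    (hs : ∀ᵐ t ∂(volume.restrict (Ioo 0 P.T)), (fun x => u (x, t)) =ᵐ[P.μΩ] z t)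
    (hA : MemLp A 2 P.μQ) (hf : MemLp f 2 P.μQ) (heq : IsWeakSolution P u A f)
    {q : Lp ℝ 2 P.μΩ × Lp (EuclideanSpace ℝ (Fin N)) 2 P.μΩ} (hq : q ∈ testGraph P) {a b : ℝ}
    (ha : a ∈ Icc 0 P.T) (hb : b ∈ Icc 0 P.T) :
    inner ℝ q.1 (z b - z a) =
      ∫ s in a..b, ∫ x in P.Ω, (inner ℝ (A (x, s)) (q.2 x) + f (x, s) * q.1 x) := by
  obtain ⟨φ, h1, h2, h3, h4, h5⟩ := hq
  have hi := integrable_pairing hA hf (Lp.memLp q.2) (Lp.memLp q.1)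
  have hi' := hi
  rw [μQ_eq_prod] at hi'
  rw [inner_sub_right]
  refine sub_eq_integral_of_weak_deriv P.T_pos (m := fun t => inner ℝ q.1 (z t))
    (B := fun s => ∫ x in P.Ω, (inner ℝ (A (x, s)) (q.2 x) + f (x, s) * q.1 x))
    (continuousOn_const.inner hz) hi'.integral_prod_right (fun ψ k1 k2 k3 => ?_) ha hb
  have e := heq _ (isTest_tensor h1 h2 h3 k1 k2 k3)
  have dφ := h1.differentiable (by simp)
  have dψ := k1.differentiable (by simp)
  have g4 : ∀ᵐ p ∂P.μQ, q.1 p.1 = φ p.1 := by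
    rw [μQ_eq_prod]
    exact Measure.quasiMeasurePreserving_fst.ae h4
  have g5 : ∀ᵐ p ∂P.μQ, q.2 p.1 = gradient φ p.1 := by
    rw [μQ_eq_prod]
    exact Measure.quasiMeasurePreserving_fst.ae h5
  -- The weak equation for φ ⊗ ψ, with φ and ∇φ replaced by the L² classes `q.1` and `q.2`.
  have e1 : ∫ p in P.QT, (u p * q.1 p.1 * deriv ψ p.2 +
      (inner ℝ (A p) (q.2 p.1) + f p * q.1 p.1) * ψ p.2) = 0 := by
    rw [← e]
    refine integral_congr_ae ?_
    filter_upwards [g4, g5] with p a4 a5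
    simp only [dt, dx, fderiv_tensor dφ dψ, a4, a5, inner_gradient_eq_sum]
    simp only [map_zero, mul_zero, add_zero, one_mul, zero_mul, zero_add, add_mul, Finset.sum_mul]
    rw [← add_assoc]
    congr 1
    · congr 1
      · ring
      · exact Finset.sum_congr rfl fun i _ => by ring
    · ring
  have bd : ∀ k : ℝ → ℝ, Continuous k → HasCompactSupport k →
      MemLp (fun p : Pt N => k p.2) ∞ P.μQ := fun k hk hk' => by
    obtain ⟨M, hM⟩ := hk.bounded_above_of_compact_support hk'
    exact memLp_top_of_bound (hk.comp continuous_snd).aestronglyMeasurable M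
      (ae_of_all _ fun p => hM p.2)
  have hv : MemLp (fun p : Pt N => q.1 p.1) 2 P.μQ := by
    rw [μQ_eq_prod]
    exact (Lp.memLp q.1).comp_fst _
  have hI : IntegrableOn (fun p : Pt N => u p * q.1 p.1 * deriv ψ p.2 +
      (inner ℝ (A p) (q.2 p.1) + f p * q.1 p.1) * ψ p.2) P.QT := by
    refine Integrable.add ?_ ?_
    · exact (hu.integrable_mul hv).mul_of_top_left
        (bd _ (k1.continuous_deriv (by simp)) k2.deriv)
    · exact hi.mul_of_top_left (bd _ k1.continuous k2)
  rw [setIntegral_QT_eq P hI] at e1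
  have hI' : Integrable (fun p : Pt N => u p * q.1 p.1) P.μQ := hu.integrable_mul hv
  rw [μQ_eq_prod] at hI'
  refine Eq.trans (integral_congr_ae ?_) e1
  filter_upwards [hs, hi'.prod_left_ae, hI'.prod_left_ae] with t st it it'
  rw [integral_add (it'.mul_const _) (it.mul_const _), integral_mul_const, integral_mul_const]
  congr 2
  rw [L2.inner_def]
  refine integral_congr_ae ?_
  filter_upwards [st] with x hx
  rw [hx]
  simp

/-- Both sides are continuous in the pair (v, ∇v) for the L² norms, so the identity extends from
C_c^∞(Ω) to the closure that defines H¹₀(Ω). -/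
theorem inner_sub_eq_of_mem_H10 (hu : MemLp u 2 P.μQ) (hz : ContinuousOn z (Icc 0 P.T))
    (hs : ∀ᵐ t ∂(volume.restrict (Ioo 0 P.T)), (fun x => u (x, t)) =ᵐ[P.μΩ] z t)
    (hA : MemLp A 2 P.μQ) (hf : MemLp f 2 P.μQ) (heq : IsWeakSolution P u A f)
    {q : Lp ℝ 2 P.μΩ × Lp (EuclideanSpace ℝ (Fin N)) 2 P.μΩ} (hq : q ∈ H10 P) {a b : ℝ}
    (ha : a ∈ Icc 0 P.T) (hb : b ∈ Icc 0 P.T) (hab : a ≤ b) :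
    inner ℝ q.1 (z b - z a) =
      ∫ s in a..b, ∫ x in P.Ω, (inner ℝ (A (x, s)) (q.2 x) + f (x, s) * q.1 x) := by
  let ν : Measure ℝ := volume.restrict (Ioo a b)
  have hν : P.μΩ.prod ν ≤ P.μQ := by
    rw [μQ_eq_prod]
    exact Measure.prod_mono le_rfl (Measure.restrict_mono (Ioo_subset_Ioo ha.1 hb.2) le_rfl)
  have hA' := hA.mono_measure hν
  have hf' := hf.mono_measure hν
  have c1 := continuous_integral_inner_comp_fst hA'
  have c2 := continuous_integral_inner_comp_fst hf'
  have hR : ∀ q : Lp ℝ 2 P.μΩ × Lp (EuclideanSpace ℝ (Fin N)) 2 P.μΩ,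
      ∫ s in a..b, ∫ x in P.Ω, (inner ℝ (A (x, s)) (q.2 x) + f (x, s) * q.1 x) =
      (∫ p, inner ℝ (A p) (q.2 p.1) ∂(P.μΩ.prod ν)) +
        ∫ p, inner ℝ (f p) (q.1 p.1) ∂(P.μΩ.prod ν) := by
    intro q
    have i1 := integrable_inner_of_memLp hA' ((Lp.memLp q.2).comp_fst ν)
    have i2 := integrable_inner_of_memLp hf' ((Lp.memLp q.1).comp_fst ν)
    rw [← integral_add i1 i2, integral_prod_symm (fun p => inner ℝ (A p) (q.2 p.1) +
      inner ℝ (f p) (q.1 p.1)) (i1.add i2), intervalIntegral.integral_of_le hab, integral_Ioc_eq_integral_Ioo]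
    simp [mul_comm, ν]
  have hcl : IsClosed {q : Lp ℝ 2 P.μΩ × Lp (EuclideanSpace ℝ (Fin N)) 2 P.μΩ |
      inner ℝ q.1 (z b - z a) =
      ∫ s in a..b, ∫ x in P.Ω, (inner ℝ (A (x, s)) (q.2 x) + f (x, s) * q.1 x)} := by
    simp only [hR]
    exact isClosed_eq (continuous_fst.inner continuous_const)
      ((c1.comp continuous_snd).add (c2.comp continuous_fst))
  exact closure_minimal (fun q hq' => inner_sub_eq_of_mem_testGraph hu hz hs hA hf heq hq' ha hb)
    hcl hq

end FixedTime

/-! ### The energy estimate -/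

lemma memLp_toLp_prodMk {X E F : Type*} [MeasurableSpace X] {μ : Measure X}
    [NormedAddCommGroup E] [InnerProductSpace ℝ E] [NormedAddCommGroup F] [InnerProductSpace ℝ F]
    {f : X → E} {g : X → F} (hf : MemLp f 2 μ) (hg : MemLp g 2 μ) :
    MemLp (fun x => WithLp.toLp 2 (f x, g x)) 2 μ := by
  let e : E × F →L[ℝ] WithLp 2 (E × F) := (WithLp.prodContinuousLinearEquiv 2 ℝ E F).symm
  have h1 := (e.comp (ContinuousLinearMap.inl ℝ E F)).comp_memLp' hf
  have h2 := (e.comp (ContinuousLinearMap.inr ℝ E F)).comp_memLp' hg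
  convert! h1.add h2 using 1
  funext x
  change e (f x, g x) = e (f x, 0) + e (0, g x)
  rw [← map_add]
  simp

/-! ### The energy identity for weak solutions on the cylinder. -/

section Identity

variable {P : Problem N} {u : Pt N → ℝ} {z : ℝ → Lp ℝ 2 P.μΩ}
  {G A : Pt N → EuclideanSpace ℝ (Fin N)} {f : Pt N → ℝ}

/-- This is `norm_sq_eq_of_weak_equation` for the pairs (A, f) and (G, u), extended by zero outside
Q_T so that time translations act on all of space-time, with `z` frozen at its zero value after `T`.
The boundary condition enters by making (z(t), G(t)) admissible in `inner_sub_eq_of_mem_H10`. -/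
theorem norm_sq_eq_of_isWeakSolution (hu : MemLp u 2 P.μQ) (hz : ContinuousOn z (Icc 0 P.T))
    (hs : ∀ᵐ t ∂(volume.restrict (Ioo 0 P.T)), (fun x => u (x, t)) =ᵐ[P.μΩ] z t)
    (hT : z P.T = 0) (hG : MemLp G 2 P.μQ)
    (hd : ∀ᵐ t ∂(volume.restrict (Ioo 0 P.T)),
      ∃ γ : Lp (EuclideanSpace ℝ (Fin N)) 2 P.μΩ, (z t, γ) ∈ H10 P ∧
        (fun x => G (x, t)) =ᵐ[P.μΩ] γ)
    (hA : MemLp A 2 P.μQ) (hf : MemLp f 2 P.μQ) (heq : IsWeakSolution P u A f) {τ : ℝ}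
    (hτ : τ ∈ Icc 0 P.T) :
    ‖z τ‖ ^ 2 = -2 * ∫ p in P.Ω ×ˢ Ioo τ P.T, (inner ℝ (A p) (G p) + f p * u p) := by
  have hQ : MeasurableSet P.QT := P.isOpen_QT.measurableSet
  set 𝒜 : Pt N → WithLp 2 (EuclideanSpace ℝ (Fin N) × ℝ) :=
    P.QT.indicator fun p => WithLp.toLp 2 (A p, f p)
  set 𝒢 : Pt N → WithLp 2 (EuclideanSpace ℝ (Fin N) × ℝ) :=
    P.QT.indicator fun p => WithLp.toLp 2 (G p, u p)
  have h𝒜 : MemLp 𝒜 2 volume :=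
    (memLp_indicator_iff_restrict hQ).2 (memLp_toLp_prodMk hA hf)
  have h𝒢 : MemLp 𝒢 2 volume :=
    (memLp_indicator_iff_restrict hQ).2 (memLp_toLp_prodMk hG hu)
  have hZ : ContinuousOn (fun t => z (min t P.T)) (Ici 0) :=
    hz.comp (by fun_prop) fun t ht => ⟨le_min ht P.T_pos.le, min_le_right _ _⟩
  have key := norm_sq_eq_of_weak_equation (T := P.T) hZ
    (fun t ht => by rw [min_eq_right ht, hT]) h𝒜 h𝒢 ?_ hτ.1
  · rw [min_eq_left hτ.2] at key
    rw [key]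
    congr 1
    have e : ∀ p, inner ℝ (𝒜 p) (𝒢 p) =
        P.QT.indicator (fun p => inner ℝ (A p) (G p) + f p * u p) p := by
      intro p
      by_cases hp : p ∈ P.QT
      · simp only [𝒜, 𝒢, indicator_of_mem hp, WithLp.prod_inner_apply]
        simp [mul_comm]
      · simp only [𝒜, 𝒢, indicator_of_notMem hp, inner_zero_left]
    simp only [e]
    rw [setIntegral_indicator hQ]
    congr 2
    ext p
    simp only [mem_inter_iff, mem_prod, mem_univ, true_and, mem_Ioi, Problem.QT, mem_Ioo]
    constructor
    · rintro ⟨h1, h2, h3, h4⟩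
      exact ⟨h2, h1, h4⟩
    · rintro ⟨h1, h2, h3⟩
      exact ⟨h2, h1, hτ.1.trans_lt h2, h3⟩
  · filter_upwards [(ae_restrict_iff' measurableSet_Ioo).1 hs,
      (ae_restrict_iff' measurableSet_Ioo).1 hd] with t ts td ht a b ha hab
    rcases le_or_gt P.T t with htT | htT
    -- For t ≥ T both sides of the weak identity vanish.
    · have h0 : ∀ x, 𝒢 (x, t) = 0 := fun x =>
        indicator_of_notMem (fun h => absurd h.2.2 (not_lt.2 htT)) _
      simp [min_eq_right htT, hT, h0]
    obtain ⟨γ, hγ, hγ'⟩ := td ⟨ht, htT⟩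
    have hu' := ts ⟨ht, htT⟩
    have e := inner_sub_eq_of_mem_H10 hu hz hs hA hf heq hγ (a := min a P.T) (b := min b P.T)
      ⟨le_min ha P.T_pos.le, min_le_right _ _⟩ ⟨le_min (ha.trans hab) P.T_pos.le, min_le_right _ _⟩
      (min_le_min_right _ hab)
    rw [min_eq_left htT.le, e, intervalIntegral.integral_of_le hab,
      intervalIntegral.integral_of_le (min_le_min_right _ hab)]
    have hsub : Ioc (min a P.T) (min b P.T) ⊆ Ioc a b := by
      intro s hs'
      refine ⟨?_, hs'.2.trans (min_le_left _ _)⟩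
      rcases min_lt_iff.1 hs'.1 with h | h
      · exact h
      · exact absurd (hs'.2.trans (min_le_right _ _)) (not_le.2 h)
    -- Cutting the interval at `T` is harmless because `𝒜` is zero from time `T` on. The single time
    -- s = T is discarded below, since Q_T is open there.
    rw [setIntegral_eq_of_subset_of_forall_sdiff_eq_zero measurableSet_Ioc hsub (f := fun s =>
      ∫ x, inner ℝ (𝒜 (x, s)) (𝒢 (x, t)))]
    · have hne : ∀ᵐ s : ℝ, s ≠ P.T := by simp [ae_iff]
      refine integral_congr_ae ?_
      filter_upwards [ae_restrict_mem measurableSet_Ioc, ae_restrict_of_ae hne] with s hs' hsT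
      have s0 : 0 < s := lt_of_le_of_lt (le_min ha P.T_pos.le) hs'.1
      have sT : s < P.T := lt_of_le_of_ne (hs'.2.trans (min_le_right _ _)) hsT
      rw [← setIntegral_eq_integral_of_forall_compl_eq_zero (s := P.Ω) (f := fun x =>
        inner ℝ (𝒜 (x, s)) (𝒢 (x, t)))]
      · refine integral_congr_ae ?_
        filter_upwards [hγ', hu', ae_restrict_mem P.isOpen_Ω.measurableSet] with x x1 x2 x3
        have m1 : (x, s) ∈ P.QT := ⟨x3, s0, sT⟩
        have m2 : (x, t) ∈ P.QT := ⟨x3, ht, htT⟩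
        simp only [𝒜, 𝒢, indicator_of_mem m1, indicator_of_mem m2, WithLp.prod_inner_apply]
        simp [mul_comm, ← x1, ← x2]
      · intro x hx
        simp only [𝒜]
        rw [indicator_of_notMem fun h => hx h.1, inner_zero_left]
    · intro s hs'
      have : P.T < s := by
        by_contra h
        have h2 := hs'.1.1
        exact hs'.2 ⟨min_lt_of_left_lt h2, le_min hs'.1.2 (not_lt.1 h)⟩
      have h0 : ∀ x, 𝒜 (x, s) = 0 := fun x =>
        indicator_of_notMem (fun h => absurd h.2.2 (not_lt.2 this.le)) _
      simp [h0]

lemma setIntegral_sq_eq (hu : MemLp u 2 P.μQ)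
    (hs : ∀ᵐ t ∂(volume.restrict (Ioo 0 P.T)), (fun x => u (x, t)) =ᵐ[P.μΩ] z t) {τ : ℝ}
    (hτ : τ ∈ Icc 0 P.T) :
    ∫ p in P.Ω ×ˢ Ioo τ P.T, u p ^ 2 = ∫ t in τ..P.T, ‖z t‖ ^ 2 := by
  have hle : Ioo τ P.T ⊆ Ioo 0 P.T := Ioo_subset_Ioo_left hτ.1
  have hi : Integrable (fun p => u p ^ 2) (P.μΩ.prod (volume.restrict (Ioo τ P.T))) := by
    refine (hu.integrable_sq).mono_measure ?_
    rw [μQ_eq_prod]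
    exact Measure.prod_mono le_rfl (Measure.restrict_mono hle le_rfl)
  have e : (volume : Measure (Pt N)).restrict (P.Ω ×ˢ Ioo τ P.T) =
      P.μΩ.prod (volume.restrict (Ioo τ P.T)) := by
    rw [Measure.prod_restrict, ← Measure.volume_eq_prod]
  rw [e, integral_prod_symm _ hi, intervalIntegral.integral_of_le hτ.2,
    integral_Ioc_eq_integral_Ioo]
  refine integral_congr_ae ?_
  filter_upwards [ae_mono (Measure.restrict_mono hle le_rfl) hs] with t ht
  rw [norm_Lp_sq]
  refine integral_congr_ae ?_
  filter_upwards [ht] with x hx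
  rw [hx, Real.norm_eq_abs, sq_abs]

end Identity

/-! ### Backward Gronwall inequality and the bounds in terms of the source. -/

/-- Gronwall after time reversal. It is applied to F(t) = ∫_0^t e(T - s) ds, which satisfies F' ≤ kF
+ M and F(0) = 0; inserting the bound for F into kF + M gives the exponential. -/
lemma le_mul_exp_of_le_integral {e : ℝ → ℝ} {T k M : ℝ} (he : ContinuousOn e (Icc 0 T))
    (hk : 0 < k) (h : ∀ τ ∈ Icc 0 T, e τ ≤ k * (∫ t in τ..T, e t) + M) {τ : ℝ}
    (hτ : τ ∈ Icc 0 T) : e τ ≤ M * Real.exp (k * (T - τ)) := by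
  have hT : 0 ≤ T := hτ.1.trans hτ.2
  -- Clamping T - t to [0, T] makes the reversed function continuous on the whole line.
  set e' : ℝ → ℝ := fun t => e (max 0 (min (T - t) T)) with he'
  have hc : Continuous e' := he.comp_continuous (by fun_prop) fun t =>
    ⟨le_max_left _ _, max_le hT (min_le_right _ _)⟩
  have ee : ∀ t ∈ Icc 0 T, e' t = e (T - t) := fun t ht => by
    simp only [he']
    rw [min_eq_left (by linarith [ht.1]), max_eq_right (by linarith [ht.2])]
  have hint : ∀ t ∈ Icc 0 T, ∫ s in (0 : ℝ)..t, e' s = ∫ s in T - t..T, e s := by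
    intro t ht
    have := intervalIntegral.integral_comp_sub_left (a := 0) (b := t) e T
    rw [sub_zero] at this
    rw [← this]
    refine intervalIntegral.integral_congr fun s hs => ee s ?_
    rw [uIcc_of_le ht.1] at hs
    exact ⟨hs.1, hs.2.trans ht.2⟩
  have hder : ∀ t, HasDerivAt (fun t => ∫ s in (0 : ℝ)..t, e' s) (e' t) t := fun t =>
    (hc.integral_hasStrictDerivAt 0 t).hasDerivAt
  have hb : ∀ t ∈ Icc 0 T, e' t ≤ k * (∫ s in (0 : ℝ)..t, e' s) + M := fun t ht => by
    rw [hint t ht, ee t ht]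
    exact h _ ⟨by linarith [ht.2], by linarith [ht.1]⟩
  have gr := le_gronwallBound_of_liminf_deriv_right_le (f := fun t => ∫ s in (0 : ℝ)..t, e' s)
    (f' := e') (δ := 0) (K := k) (ε := M) (a := 0) (b := T)
    (fun t _ => (hder t).continuousAt.continuousWithinAt)
    (fun t _ r hr => (hder t).hasDerivWithinAt.liminf_right_slope_le hr)
    (by simp) (fun t ht => hb t (Ico_subset_Icc_self ht)) (T - τ)
    ⟨by linarith [hτ.2], by linarith [hτ.1]⟩
  have b1 := hb (T - τ) ⟨by linarith [hτ.2], by linarith [hτ.1]⟩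
  rw [ee (T - τ) ⟨by linarith [hτ.2], by linarith [hτ.1]⟩, sub_sub_cancel] at b1
  rw [gronwallBound_of_K_ne_0 hk.ne'] at gr
  simp only [zero_mul, zero_add, sub_zero] at gr
  have := mul_le_mul_of_nonneg_left gr hk.le
  have e3 : k * (M / k * (Real.exp (k * (T - τ)) - 1)) =
      M * Real.exp (k * (T - τ)) - M := by field_simp
  linarith

/-- The flux `c G`. -/
def Problem.flux (P : Problem N) (G : Pt N → EuclideanSpace ℝ (Fin N)) (p : Pt N) :
    EuclideanSpace ℝ (Fin N) :=
  WithLp.toLp 2 fun i => ∑ j, P.c p.1 i j * G p j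

lemma Problem.memLp_flux (P : Problem N) {G : Pt N → EuclideanSpace ℝ (Fin N)}
    (hG : MemLp G 2 P.μQ) : MemLp (P.flux G) 2 P.μQ := by
  have hj : ∀ j, MemLp (fun p => G p j) 2 P.μQ := fun j =>
    (EuclideanSpace.proj (𝕜 := ℝ) j).comp_memLp' hG
  have hs : ∀ i, MemLp (fun p : Pt N => ∑ j, P.c p.1 i j * G p j) 2 P.μQ := fun i =>
    memLp_finsetSum _ fun j _ => MemLp.mul (r := 2) (hj j) (memLp_top_c i j)
  have h : ∀ i, MemLp (fun p => (∑ j, P.c p.1 i j * G p j) •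
      (EuclideanSpace.single i (1 : ℝ) : EuclideanSpace ℝ (Fin N))) 2 P.μQ := fun i =>
    (ContinuousLinearMap.toSpanSingleton ℝ
      (EuclideanSpace.single i (1 : ℝ) : EuclideanSpace ℝ (Fin N))).comp_memLp' (hs i)
  convert! memLp_finsetSum Finset.univ fun i _ => h i using 1
  funext p
  ext k
  simp [Problem.flux, Pi.single_apply]

lemma Problem.le_inner_flux (P : Problem N) (G : Pt N → EuclideanSpace ℝ (Fin N)) {p : Pt N}
    (hp : p ∈ P.QT) : P.c₀ * ‖G p‖ ^ 2 ≤ inner ℝ (P.flux G p) (G p) := by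
  refine (P.elliptic p.1 (subset_closure hp.1) (G p)).trans_eq ?_
  rw [PiLp.inner_apply]
  refine Finset.sum_congr rfl fun i _ => ?_
  simp [Problem.flux, Finset.mul_sum, mul_comm]

lemma Problem.exists_bound_d (P : Problem N) : ∃ D, 0 ≤ D ∧ ∀ᵐ p ∂P.μQ, |P.d p| ≤ D := by
  refine ⟨(eLpNormEssSup P.d P.μQ).toReal, ENNReal.toReal_nonneg, ?_⟩
  have h := P.memLp_d.2
  rw [eLpNorm_exponent_top] at h
  filter_upwards [ae_le_eLpNormEssSup (f := P.d) (μ := P.μQ)] with p hp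
  rw [← Real.norm_eq_abs, ← toReal_enorm]
  exact ENNReal.toReal_mono h.ne hp

namespace Setting

variable {P : Problem N} {W : Setting P} {u : Pt N → ℝ} {z : ℝ → Lp ℝ 2 P.μΩ}
  {G : Lp (EuclideanSpace ℝ (Fin N)) 2 P.μQ} {h : Lp ℝ 2 P.μQ}

lemma IsBackward.isWeakSolution (H : W.IsBackward u z G h) (hu : MemLp u 2 P.μQ) :
    IsWeakSolution P u (P.flux G) fun p => P.d p * u p - (W.ρ₀ p)⁻¹ * h p := by
  intro φ hφ
  have e := integral_sub (integrable_lhs hu G hφ) (W.integrable_rhs h hφ)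
  rw [H.equation φ hφ, sub_self] at e
  rw [← e]
  refine integral_congr_ae (ae_of_all _ fun p => ?_)
  simp only [Problem.flux, Finset.sum_mul]
  ring

/-- The energy identity combined with ellipticity. The source is integrated over all of Q_T so that
its contribution does not depend on τ, as Gronwall requires; the gradient is kept on the left for
use in the completeness proof. -/
lemma IsBackward.norm_sq_add_le (H : W.IsBackward u z G h) (hu : MemLp u 2 P.μQ) {D : ℝ}
    (hD : ∀ᵐ p ∂P.μQ, |P.d p| ≤ D) {τ : ℝ} (hτ : τ ∈ Icc 0 P.T) :
    ‖z τ‖ ^ 2 + 2 * P.c₀ * ∫ p in P.Ω ×ˢ Ioo τ P.T, ‖G p‖ ^ 2 ≤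
      (2 * D + 1) * (∫ t in τ..P.T, ‖z t‖ ^ 2) + ∫ p in P.QT, ((W.ρ₀ p)⁻¹ * h p) ^ 2 := by
  have hA := P.memLp_flux (Lp.memLp G)
  have hg := W.memLp_source h
  have hdu : MemLp (fun p => P.d p * u p) 2 P.μQ := hu.mul P.memLp_d
  have hf := hdu.sub hg
  have hsub : P.Ω ×ˢ Ioo τ P.T ⊆ P.QT := prod_mono subset_rfl (Ioo_subset_Ioo_left hτ.1)
  have hle := Measure.restrict_mono hsub (le_refl (volume : Measure (Pt N)))
  have iG : IntegrableOn (fun p => ‖G p‖ ^ 2) (P.Ω ×ˢ Ioo τ P.T) :=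
    ((Lp.memLp G).integrable_norm_pow (p := 2) (by norm_num)).mono_measure hle
  have iu : IntegrableOn (fun p => u p ^ 2) (P.Ω ×ˢ Ioo τ P.T) := hu.integrable_sq.mono_measure hle
  have ig := hg.integrable_sq
  have ig' : IntegrableOn (fun p => ((W.ρ₀ p)⁻¹ * h p) ^ 2) (P.Ω ×ˢ Ioo τ P.T) :=
    ig.mono_measure hle
  have iL : IntegrableOn (fun p => inner ℝ (P.flux G p) (G p) +
      (P.d p * u p - (W.ρ₀ p)⁻¹ * h p) * u p) (P.Ω ×ˢ Ioo τ P.T) :=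
    ((integrable_inner_of_memLp hA (Lp.memLp G)).add (hf.integrable_mul hu)).mono_measure hle
  have e := norm_sq_eq_of_isWeakSolution hu H.continuousOn H.slice H.terminal (Lp.memLp G)
    H.dirichlet hA hf (H.isWeakSolution hu) hτ
  have ia : IntegrableOn (fun p => (2 * D + 1) * u p ^ 2 + ((W.ρ₀ p)⁻¹ * h p) ^ 2)
      (P.Ω ×ˢ Ioo τ P.T) := (iu.const_mul _).add ig'
  have m : ∫ p in P.Ω ×ˢ Ioo τ P.T, -2 * (inner ℝ (P.flux G p) (G p) +
      (P.d p * u p - (W.ρ₀ p)⁻¹ * h p) * u p) ≤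
      ∫ p in P.Ω ×ˢ Ioo τ P.T, (((2 * D + 1) * u p ^ 2 + ((W.ρ₀ p)⁻¹ * h p) ^ 2) -
        2 * P.c₀ * ‖G p‖ ^ 2) := by
    refine integral_mono_ae (iL.const_mul _) (ia.sub (iG.const_mul _)) ?_
    filter_upwards [ae_mono hle hD, ae_mono hle (ae_restrict_mem P.isOpen_QT.measurableSet)]
      with p h1 h2
    have h3 := P.le_inner_flux G h2
    have h4 : -(P.d p * u p ^ 2) ≤ D * u p ^ 2 := by
      rw [← neg_mul]
      exact mul_le_mul_of_nonneg_right ((neg_le_abs _).trans h1) (sq_nonneg _)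
    -- This square is Young's inequality 2gu ≤ u² + g² for the source g = ρ₀⁻¹h, the origin of the
    -- +1 in 2D + 1.
    nlinarith [sq_nonneg (u p - (W.ρ₀ p)⁻¹ * h p)]
  rw [integral_sub ia (iG.const_mul _),
    integral_add (iu.const_mul _) ig', integral_const_mul, integral_const_mul,
    integral_const_mul, setIntegral_sq_eq hu H.slice hτ] at m
  have m2 : ∫ p in P.Ω ×ˢ Ioo τ P.T, ((W.ρ₀ p)⁻¹ * h p) ^ 2 ≤
      ∫ p in P.QT, ((W.ρ₀ p)⁻¹ * h p) ^ 2 :=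
    setIntegral_mono_set ig (ae_of_all _ fun p => sq_nonneg _) hsub.eventuallyLE
  have e' : ‖z τ‖ ^ 2 = -2 * ∫ p in P.Ω ×ˢ Ioo τ P.T, (inner ℝ (P.flux G p) (G p) +
      (P.d p * u p - (W.ρ₀ p)⁻¹ * h p) * u p) := e
  linarith

theorem exists_energy_estimate (P : Problem N) : ∃ C > 0, ∀ (W : Setting P) (u : Pt N → ℝ)
    (z : ℝ → Lp ℝ 2 P.μΩ) (G : Lp (EuclideanSpace ℝ (Fin N)) 2 P.μQ) (h : Lp ℝ 2 P.μQ),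
    MemLp u 2 P.μQ → W.IsBackward u z G h →
      (∀ t ∈ Icc 0 P.T, ‖z t‖ ^ 2 ≤ C * ∫ p in P.QT, ((W.ρ₀ p)⁻¹ * h p) ^ 2) ∧
      ‖G‖ ^ 2 ≤ C * (∫ p in P.QT, ((W.ρ₀ p)⁻¹ * h p) ^ 2) ∧
      ∫ p in P.QT, u p ^ 2 ≤ C * ∫ p in P.QT, ((W.ρ₀ p)⁻¹ * h p) ^ 2 := by
  obtain ⟨D, hD0, hD⟩ := P.exists_bound_d
  set k := 2 * D + 1
  have hk : 0 < k := by positivity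
  have hT := P.T_pos
  have hc := P.c₀_pos
  set C₁ := Real.exp (k * P.T)
  have hC₁ : 0 < C₁ := Real.exp_pos _
  set C₂ := (k * (P.T * C₁) + 1) / (2 * P.c₀)
  have hC₂ : 0 < C₂ := by positivity
  -- The summands bound the trace at each time, the gradient, and the L² norm on Q_T. They involve
  -- only T, c₀ and D, so the constant is chosen before the setting `W`.
  refine ⟨C₁ + C₂ + P.T * C₁, by positivity, fun W u z G h hu H => ?_⟩
  set M := ∫ p in P.QT, ((W.ρ₀ p)⁻¹ * h p) ^ 2
  have hM : 0 ≤ M := integral_nonneg fun p => sq_nonneg _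
  have b1 : ∀ t ∈ Icc 0 P.T, ‖z t‖ ^ 2 ≤ C₁ * M := by
    intro t ht
    have := le_mul_exp_of_le_integral (e := fun t => ‖z t‖ ^ 2) (M := M)
      (H.continuousOn.norm.pow 2) hk (fun τ hτ => by
        have h1 := H.norm_sq_add_le hu hD hτ
        have h2 : 0 ≤ ∫ p in P.Ω ×ˢ Ioo τ P.T, ‖G p‖ ^ 2 := integral_nonneg fun p => sq_nonneg _
        have h3 : 0 ≤ 2 * P.c₀ * ∫ p in P.Ω ×ˢ Ioo τ P.T, ‖G p‖ ^ 2 := by positivity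
        linarith) ht
    refine this.trans ?_
    rw [mul_comm]
    refine mul_le_mul_of_nonneg_right (Real.exp_le_exp.2 ?_) hM
    exact mul_le_mul_of_nonneg_left (by linarith [ht.1]) hk.le
  have h0 : (0 : ℝ) ∈ Icc 0 P.T := ⟨le_rfl, hT.le⟩
  have b2 : ∫ t in (0 : ℝ)..P.T, ‖z t‖ ^ 2 ≤ P.T * C₁ * M := by
    have hi : IntervalIntegrable (fun t => ‖z t‖ ^ 2) volume 0 P.T := by
      refine ContinuousOn.intervalIntegrable ?_
      rw [uIcc_of_le hT.le]
      exact H.continuousOn.norm.pow 2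
    have := intervalIntegral.integral_mono_on hT.le hi (intervalIntegrable_const (c := C₁ * M)) b1
    refine this.trans_eq ?_
    simp
    ring
  have b3 := H.norm_sq_add_le hu hD h0
  have b4 := setIntegral_sq_eq hu H.slice h0
  have q1 : 0 ≤ C₁ * M := by positivity
  have q2 : 0 ≤ C₂ * M := by positivity
  have q3 : 0 ≤ P.T * C₁ * M := by positivity
  refine ⟨fun t ht => (b1 t ht).trans (by linarith), ?_, ?_⟩
  · rw [norm_Lp_sq]
    have b5 : 2 * P.c₀ * ∫ p in P.QT, ‖G p‖ ^ 2 ≤ (k * (P.T * C₁) + 1) * M := by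
      have := mul_le_mul_of_nonneg_left b2 hk.le
      have b3' : ‖z 0‖ ^ 2 + 2 * P.c₀ * ∫ p in P.QT, ‖G p‖ ^ 2 ≤
        k * (∫ t in (0 : ℝ)..P.T, ‖z t‖ ^ 2) + M := b3
      linarith [sq_nonneg ‖z 0‖]
    have b6 : ∫ p in P.QT, ‖G p‖ ^ 2 ≤ C₂ * M := by
      rw [show C₂ * M = (k * (P.T * C₁) + 1) * M / (2 * P.c₀) by simp only [C₂]; ring,
        le_div_iff₀ (by positivity)]
      linarith
    exact b6.trans (by linarith)
  · have b4' : ∫ p in P.QT, u p ^ 2 = ∫ t in (0 : ℝ)..P.T, ‖z t‖ ^ 2 := b4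
    rw [b4']
    linarith

/-- The source ρ₀⁻¹h is L⋆(ρ⁻¹λ) itself, so neither weight enters the constant. -/
theorem exists_isEnergyConstant (P : Problem N) :
    ∃ C > 0, ∀ W : Setting P, W.IsEnergyConstant C := by
  obtain ⟨C, hC, h⟩ := exists_energy_estimate P
  refine ⟨√C, Real.sqrt_pos.2 hC, fun W l => ?_⟩
  obtain ⟨z, G, H⟩ := W.wLstar_spec l
  rw [← Real.sqrt_mul hC.le]
  exact Real.sqrt_le_sqrt (h W _ z G _ (W.memLp_scaled _) H).2.2

end Setting

/-! ### Completeness of the multiplier space -/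

lemma eLpNorm_two_sq_eq_lintegral {X E : Type*} [MeasurableSpace X] [NormedAddCommGroup E]
    (μ : Measure X) (f : X → E) : eLpNorm f 2 μ ^ 2 = ∫⁻ x, ‖f x‖ₑ ^ 2 ∂μ := by
  have := eLpNorm_nnreal_pow_eq_lintegral (μ := μ) (f := f) (p := 2) (by norm_num)
  simpa using this

lemma lintegral_eLpNorm_slice_sq {P : Problem N} {E : Type*} [NormedAddCommGroup E]
    {f : Pt N → E} (hf : AEStronglyMeasurable f P.μQ) :
    AEMeasurable (fun t => eLpNorm (fun x => f (x, t)) 2 P.μΩ ^ 2)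
        (volume.restrict (Ioo 0 P.T)) ∧
      ∫⁻ t in Ioo 0 P.T, eLpNorm (fun x => f (x, t)) 2 P.μΩ ^ 2 = eLpNorm f 2 P.μQ ^ 2 := by
  rw [μQ_eq_prod] at hf ⊢
  simp only [eLpNorm_two_sq_eq_lintegral]
  have hm := hf.enorm.pow_const 2
  exact ⟨hm.prod_swap.lintegral_prod_right', (lintegral_prod_symm _ hm).symm⟩

lemma ae_memLp_slice {P : Problem N} {E : Type*} [NormedAddCommGroup E]
    {f : Pt N → E} (hf : MemLp f 2 P.μQ) :
    ∀ᵐ t ∂(volume.restrict (Ioo 0 P.T)), MemLp (fun x => f (x, t)) 2 P.μΩ := by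
  obtain ⟨m, e⟩ := lintegral_eLpNorm_slice_sq hf.1
  have hm := hf.1
  rw [μQ_eq_prod] at hm
  filter_upwards [hm.prod_swap.prodMk_left, ae_lt_top' m (e ▸ ENNReal.pow_ne_top hf.2.ne)]
    with t a b
  exact ⟨a, (ENNReal.pow_lt_top_iff.1 b).resolve_right two_ne_zero⟩

/-- Along a subsequence with squared distances at most 2⁻ⁿ, the sum over n of the squared slice
distances is integrable in t. It is therefore finite for almost every t, and its terms tend to zero.
One subsequence serves almost all times. -/
lemma exists_subseq_ae_slice_tendsto {P : Problem N} {E : Type*} [NormedAddCommGroup E]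
    {F : ℕ → Lp E 2 P.μQ} {F₀ : Lp E 2 P.μQ} (h : Tendsto F atTop (𝓝 F₀)) :
    ∃ ns : ℕ → ℕ, StrictMono ns ∧ ∀ᵐ t ∂(volume.restrict (Ioo 0 P.T)),
      ∀ γ : ℕ → Lp E 2 P.μΩ, (∀ n, (fun x => F n (x, t)) =ᵐ[P.μΩ] γ n) →
        ∃ g : Lp E 2 P.μΩ, (fun x => F₀ (x, t)) =ᵐ[P.μΩ] g ∧
          Tendsto (fun n => γ (ns n)) atTop (𝓝 g) := by
  have hk : Tendsto (fun n => eLpNorm (fun p => F n p - F₀ p) 2 P.μQ ^ 2) atTop (𝓝 0) := by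
    have := (ENNReal.continuous_pow 2).tendsto 0 |>.comp
      ((Lp.tendsto_Lp_iff_tendsto_eLpNorm' F F₀).1 h)
    rwa [zero_pow two_ne_zero] at this
  obtain ⟨ns, hns, hb⟩ := extraction_forall_of_eventually' (P := fun n k =>
    eLpNorm (fun p => F k p - F₀ p) 2 P.μQ ^ 2 ≤ (2⁻¹ : ℝ≥0∞) ^ n) fun n => by
      have h2 : (0 : ℝ≥0∞) < 2⁻¹ ^ n := by
        rw [pos_iff_ne_zero]
        exact pow_ne_zero _ (by simp)
      exact eventually_atTop.1 (hk.eventually (Iic_mem_nhds h2))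
  refine ⟨ns, hns, ?_⟩
  have hs := fun n => lintegral_eLpNorm_slice_sq (P := P) (f := fun p => F (ns n) p - F₀ p)
    ((Lp.aestronglyMeasurable (F (ns n))).sub (Lp.aestronglyMeasurable F₀))
  have hsum : ∀ᵐ t ∂(volume.restrict (Ioo 0 P.T)),
      ∑' n, eLpNorm (fun x => F (ns n) (x, t) - F₀ (x, t)) 2 P.μΩ ^ 2 < ∞ := by
    refine ae_lt_top' (AEMeasurable.tsum fun n => (hs n).1) ?_
    rw [lintegral_tsum fun n => (hs n).1]
    refine ne_top_of_le_ne_top ?_ (ENNReal.tsum_le_tsum fun n => (hs n).2.trans_le (hb n))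
    rw [ENNReal.tsum_geometric]
    simp
  filter_upwards [hsum, ae_memLp_slice (Lp.memLp F₀)] with t h1 h2 γ hγ
  refine ⟨h2.toLp _, h2.coeFn_toLp.symm, ?_⟩
  rw [Lp.tendsto_Lp_iff_tendsto_eLpNorm']
  have h3 := ENNReal.tendsto_atTop_zero_of_tsum_ne_top h1.ne
  have h4 := (ENNReal.continuous_rpow_const (y := (2⁻¹ : ℝ))).tendsto 0 |>.comp h3
  rw [ENNReal.zero_rpow_of_pos (by norm_num)] at h4
  refine h4.congr fun n => ?_
  simp only [Function.comp_apply]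
  rw [← ENNReal.rpow_natCast, ← ENNReal.rpow_mul]
  norm_num
  refine eLpNorm_congr_ae ?_
  filter_upwards [hγ (ns n), h2.coeFn_toLp] with x a b
  rw [Pi.sub_apply, ← a, b]

section EquationLimit

variable {P : Problem N}

lemma continuous_integral_mul {k : Pt N → ℝ} (hk : MemLp k 2 P.μQ) :
    Continuous fun F : Lp ℝ 2 P.μQ => ∫ p in P.QT, F p * k p := by
  have : (fun F : Lp ℝ 2 P.μQ => ∫ p in P.QT, F p * k p) =
      fun F => inner ℝ (hk.toLp k) F := by
    funext F
    rw [← Lp.toLp_coeFn F (Lp.memLp F), inner_toLp]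
    exact integral_congr_ae (ae_of_all _ fun p => by simp)
  rw [this]
  exact continuous_const.inner continuous_id

lemma continuous_integral_component_mul {k : Pt N → ℝ} (hk : MemLp k 2 P.μQ) (j : Fin N) :
    Continuous fun G : Lp (EuclideanSpace ℝ (Fin N)) 2 P.μQ => ∫ p in P.QT, G p j * k p := by
  let L := ContinuousLinearMap.compLpL 2 P.μQ 
    (EuclideanSpace.proj j : EuclideanSpace ℝ (Fin N) →L[ℝ] ℝ)
  have e : (fun G : Lp (EuclideanSpace ℝ (Fin N)) 2 P.μQ => ∫ p in P.QT, G p j * k p) =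
      fun G => ∫ p in P.QT, L G p * k p := by
    funext G
    refine integral_congr_ae ?_
    filter_upwards [ContinuousLinearMap.coeFn_compLpL
      (EuclideanSpace.proj j : EuclideanSpace ℝ (Fin N) →L[ℝ] ℝ) G] with p hp
    simp only [L]
    rw [hp]
    rfl
  rw [e]
  exact (continuous_integral_mul hk).comp L.continuous

/-- For fixed φ the left side of the weak equation is a finite sum of pairings of u and the
components of G with fixed L² functions. -/
lemma continuous_weakLstar {φ : Pt N → ℝ} (hφ : IsTest P φ) :
    Continuous fun q : Lp ℝ 2 P.μQ × Lp (EuclideanSpace ℝ (Fin N)) 2 P.μQ =>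
      ∫ p in P.QT, (q.1 p * dt φ p + (∑ i, ∑ j, P.c p.1 i j * q.2 p j * dx i φ p) +
        P.d p * q.1 p * φ p) := by
  have m0 : MemLp (fun p => dt φ p + P.d p * φ p) 2 P.μQ :=
    memLp_two_of_top ((Problem.memLp_top_fderiv hφ.contDiffOn _).add
      ((Problem.memLp_top_self hφ.contDiffOn).mul P.memLp_d))
  have m1 : ∀ i j, MemLp (fun p => P.c p.1 i j * dx i φ p) 2 P.μQ := fun i j =>
    memLp_two_of_top ((Problem.memLp_top_fderiv hφ.contDiffOn _).mul (Problem.memLp_top_c i j))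
  have e : (fun q : Lp ℝ 2 P.μQ × Lp (EuclideanSpace ℝ (Fin N)) 2 P.μQ =>
      ∫ p in P.QT, (q.1 p * dt φ p + (∑ i, ∑ j, P.c p.1 i j * q.2 p j * dx i φ p) +
        P.d p * q.1 p * φ p)) = fun q => (∫ p in P.QT, q.1 p * (dt φ p + P.d p * φ p)) +
      ∑ i, ∑ j, ∫ p in P.QT, q.2 p j * (P.c p.1 i j * dx i φ p) := by
    funext q
    have i1 : ∀ i j, Integrable (fun p => q.2 p j * (P.c p.1 i j * dx i φ p)) P.μQ := fun i j => by
      have hG : MemLp (fun p => q.2 p j) 2 P.μQ :=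
        (EuclideanSpace.proj (𝕜 := ℝ) j).comp_memLp' (Lp.memLp q.2)
      exact hG.integrable_mul (m1 i j)
    have i0 : Integrable (fun p => q.1 p * (dt φ p + P.d p * φ p)) P.μQ :=
      (Lp.memLp q.1).integrable_mul m0
    have e1 : ∀ i, ∑ j, ∫ p in P.QT, q.2 p j * (P.c p.1 i j * dx i φ p) =
        ∫ p in P.QT, ∑ j, q.2 p j * (P.c p.1 i j * dx i φ p) := fun i =>
      (integral_finsetSum _ fun j _ => i1 i j).symm
    simp only [e1]
    rw [← integral_finsetSum _ fun i _ => integrable_finsetSum _ fun j _ => i1 i j,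
      ← integral_add i0
        (integrable_finsetSum _ fun i _ => integrable_finsetSum _ fun j _ => i1 i j)]
    refine integral_congr_ae (ae_of_all _ fun p => ?_)
    have e2 : ∑ i, ∑ j, P.c p.1 i j * q.2 p j * dx i φ p =
        ∑ i, ∑ j, q.2 p j * (P.c p.1 i j * dx i φ p) :=
      Finset.sum_congr rfl fun i _ => Finset.sum_congr rfl fun j _ => by ring
    simp only [e2]
    ring
  rw [e]
  refine ((continuous_integral_mul m0).comp continuous_fst).add ?_
  exact continuous_finsetSum _ fun i _ => continuous_finsetSum _ fun j _ =>
    (continuous_integral_component_mul (m1 i j) j).comp continuous_snd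

end EquationLimit

namespace Setting

variable {P : Problem N} {W : Setting P}

lemma IsBackward.sub {u u' : Pt N → ℝ} (hu : MemLp u 2 P.μQ) (hu' : MemLp u' 2 P.μQ)
    {z z' : ℝ → Lp ℝ 2 P.μΩ} {G G' : Lp (EuclideanSpace ℝ (Fin N)) 2 P.μQ} {h h' : Lp ℝ 2 P.μQ}
    (H : W.IsBackward u z G h) (H' : W.IsBackward u' z' G' h') :
    W.IsBackward (u - u') (z - z') (G - G') (h - h') := by
  have := H.add hu (hu'.const_smul (-1)) (H'.smul (-1))
  simpa only [neg_one_smul, ← sub_eq_add_neg] using this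

variable (W)

lemma integral_source_sq_le (h : Lp ℝ 2 P.μQ) :
    ∫ p in P.QT, ((W.ρ₀ p)⁻¹ * h p) ^ 2 ≤ (W.ρstar ^ 2)⁻¹ * ‖h‖ ^ 2 := by
  rw [norm_Lp_sq, ← integral_const_mul]
  refine integral_mono_ae (W.memLp_source h).integrable_sq
    (((Lp.memLp h).integrable_norm_pow (p := 2) (by norm_num)).const_mul _) ?_
  filter_upwards [ae_restrict_mem P.isOpen_QT.measurableSet] with p hp
  have h1 := W.isWeight_ρ₀.lower p hp
  have h2 := W.ρstar_pos
  rw [mul_pow, inv_pow, Real.norm_eq_abs, sq_abs]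
  gcongr

lemma norm_scaled_le (l : W.Lam) : ‖W.scaled l‖ ≤ ‖l‖ := by
  refine le_of_sq_le_sq ?_ (norm_nonneg _)
  rw [W.norm_sq_Lam]
  exact le_add_of_nonneg_right (sq_nonneg _)

lemma norm_wLstar_le (l : W.Lam) : ‖W.wLstar l‖ ≤ ‖l‖ := by
  refine le_of_sq_le_sq ?_ (norm_nonneg _)
  rw [W.norm_sq_Lam]
  exact le_add_of_nonneg_left (sq_nonneg _)

/-- `λ ↦ ρ⁻¹λ` as a continuous map. -/
def scaledL : W.Lam →L[ℝ] Lp ℝ 2 P.μQ :=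
  W.scaled.mkContinuous 1 fun l => by
    rw [one_mul]
    exact W.norm_scaled_le l

/-- `λ ↦ ρ₀ L⋆(ρ⁻¹λ)` as a continuous map. -/
def wLstarL : W.Lam →L[ℝ] Lp ℝ 2 P.μQ :=
  W.wLstar.mkContinuous 1 fun l => by
    rw [one_mul]
    exact W.norm_wLstar_le l

variable {W}

/-- Closedness of the backward problem. The energy estimate for differences makes `z n` uniformly
Cauchy on [0, T] and `G n` Cauchy in L²; continuity and the terminal value pass to the uniform
limit, the boundary condition because H¹₀(Ω) is closed, and the equation because it is continuous in
its data. -/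
lemma exists_isBackward_limit {u : ℕ → Lp ℝ 2 P.μQ} {z : ℕ → ℝ → Lp ℝ 2 P.μΩ}
    {G : ℕ → Lp (EuclideanSpace ℝ (Fin N)) 2 P.μQ} {h : ℕ → Lp ℝ 2 P.μQ}
    (H : ∀ n, W.IsBackward (u n) (z n) (G n) (h n)) {u₀ h₀ : Lp ℝ 2 P.μQ}
    (hu : Tendsto u atTop (𝓝 u₀)) (hh : Tendsto h atTop (𝓝 h₀)) :
    ∃ z₀ G₀, W.IsBackward u₀ z₀ G₀ h₀ := by
  obtain ⟨C, hC, est⟩ := exists_energy_estimate P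
  set K := √(C * (W.ρstar ^ 2)⁻¹)
  have hK : 0 ≤ K := Real.sqrt_nonneg _
  have bd : ∀ n m, (∀ t ∈ Icc 0 P.T, ‖z n t - z m t‖ ≤ K * ‖h n - h m‖) ∧
      ‖G n - G m‖ ≤ K * ‖h n - h m‖ := by
    intro n m
    have e := est W _ _ _ _ ((Lp.memLp (u n)).sub (Lp.memLp (u m)))
      ((H n).sub (Lp.memLp _) (Lp.memLp _) (H m))
    have s := mul_le_mul_of_nonneg_left (W.integral_source_sq_le (h n - h m)) hC.le
    have s2 : (K * ‖h n - h m‖) ^ 2 = C * ((W.ρstar ^ 2)⁻¹ * ‖h n - h m‖ ^ 2) := by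
      rw [mul_pow, Real.sq_sqrt (by positivity), mul_assoc]
    rw [← s2] at s
    exact ⟨fun t ht => le_of_sq_le_sq ((e.1 t ht).trans s) (by positivity),
      le_of_sq_le_sq (e.2.1.trans s) (by positivity)⟩
  have hc := hh.cauchySeq
  have cauchy : ∀ ε > 0, ∃ n₀, ∀ n ≥ n₀, ∀ m ≥ n₀, K * ‖h n - h m‖ < ε := by
    intro ε hε
    -- Dividing by K + 1 avoids a separate proof that `K` is nonzero.
    obtain ⟨n₀, hn₀⟩ := Metric.cauchySeq_iff.1 hc (ε / (K + 1)) (by positivity)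
    refine ⟨n₀, fun n hn m hm => ?_⟩
    have := hn₀ n hn m hm
    rw [dist_eq_norm, lt_div_iff₀ (by positivity)] at this
    nlinarith [norm_nonneg (h n - h m)]
  have cG : CauchySeq G := by
    refine Metric.cauchySeq_iff.2 fun ε hε => ?_
    obtain ⟨n₀, hn₀⟩ := cauchy ε hε
    refine ⟨n₀, fun n hn m hm => ?_⟩
    rw [dist_eq_norm]
    exact (bd n m).2.trans_lt (hn₀ n hn m hm)
  obtain ⟨G₀, hG₀⟩ := cauchySeq_tendsto_of_complete cG
  have uc : UniformCauchySeqOn z atTop (Icc 0 P.T) := by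
    refine Metric.uniformCauchySeqOn_iff.2 fun ε hε => ?_
    obtain ⟨n₀, hn₀⟩ := cauchy ε hε
    refine ⟨n₀, fun n hn m hm t ht => ?_⟩
    rw [dist_eq_norm]
    exact ((bd n m).1 t ht).trans_lt (hn₀ n hn m hm)
  have ex : ∀ t, ∃ w, t ∈ Icc 0 P.T → Tendsto (fun n => z n t) atTop (𝓝 w) := fun t => by
    by_cases ht : t ∈ Icc 0 P.T
    · obtain ⟨w, hw⟩ := cauchySeq_tendsto_of_complete (uc.cauchySeq ht)
      exact ⟨w, fun _ => hw⟩
    · exact ⟨0, fun h => absurd h ht⟩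
  choose z₀ hz₀ using ex
  have unif := uc.tendstoUniformlyOn_of_tendsto fun t ht => hz₀ t ht
  refine ⟨z₀, G₀, ?_, ?_, ?_, ?_, ?_⟩
  · exact unif.continuousOn (Frequently.of_forall fun n => (H n).continuousOn)
  · obtain ⟨ns, hns, hsl⟩ := exists_subseq_ae_slice_tendsto hu
    filter_upwards [hsl, ae_all_iff.2 fun n => (H n).slice, ae_restrict_mem measurableSet_Ioo]
      with t a b ht
    obtain ⟨g, hg, hg'⟩ := a (fun n => z n t) b
    rwa [tendsto_nhds_unique ((hz₀ t (Ioo_subset_Icc_self ht)).comp hns.tendsto_atTop) hg']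
  · refine tendsto_nhds_unique (hz₀ _ ⟨P.T_pos.le, le_rfl⟩) ?_
    simp only [(H _).terminal]
    exact tendsto_const_nhds
  · obtain ⟨ns, hns, hsl⟩ := exists_subseq_ae_slice_tendsto hG₀
    filter_upwards [hsl, ae_all_iff.2 fun n => (H n).dirichlet, ae_restrict_mem measurableSet_Ioo]
      with t a b ht
    choose γ hγ hγ' using b
    obtain ⟨g, hg, hg'⟩ := a γ hγ'
    refine ⟨g, ?_, hg⟩
    have hcl : IsClosed (H10 P : Set (Lp ℝ 2 P.μΩ × Lp (EuclideanSpace ℝ (Fin N)) 2 P.μΩ)) :=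
      (testGraph P).isClosed_topologicalClosure
    exact hcl.mem_of_tendsto
      (((hz₀ t (Ioo_subset_Icc_self ht)).comp hns.tendsto_atTop).prodMk_nhds hg')
      (Eventually.of_forall fun n => hγ (ns n))
  · intro φ hφ
    have l1 := ((continuous_weakLstar hφ).tendsto (u₀, G₀)).comp (hu.prodMk_nhds hG₀)
    have mφ : MemLp (fun p => (W.ρ₀ p)⁻¹ * φ p) 2 P.μQ :=
      memLp_two_of_top ((Problem.memLp_top_self hφ.contDiffOn).mul
        (W.isWeight_ρ₀.memLp_inv W.ρstar_pos))
    have l2 := ((continuous_integral_mul mφ).tendsto h₀).comp hh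
    have e : ∀ k : Lp ℝ 2 P.μQ, ∫ p in P.QT, (W.ρ₀ p)⁻¹ * k p * φ p =
        ∫ p in P.QT, k p * ((W.ρ₀ p)⁻¹ * φ p) := fun k =>
      integral_congr_ae (ae_of_all _ fun p => by ring)
    rw [e]
    refine tendsto_nhds_unique l1 (l2.congr fun n => ?_)
    simp only [Function.comp_apply]
    rw [← e]
    exact ((H n).equation φ hφ).symm

/-- The norm of `Λ` is that of the pair (ρ⁻¹λ, ρ₀L⋆(ρ⁻¹λ)) in L² × L², so completeness amounts to
the set of such pairs being closed. -/
instance : CompleteSpace W.Lam := by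
  refine Metric.complete_of_cauchySeq_tendsto fun l hl => ?_
  obtain ⟨u₀, hu⟩ := cauchySeq_tendsto_of_complete (W.scaledL.uniformContinuous.comp_cauchySeq hl)
  obtain ⟨h₀, hh⟩ := cauchySeq_tendsto_of_complete (W.wLstarL.uniformContinuous.comp_cauchySeq hl)
  choose z G H using fun n => W.wLstar_spec (l n)
  obtain ⟨z₀, G₀, H₀⟩ := exists_isBackward_limit (u := fun n => W.scaled (l n))
    (h := fun n => W.wLstar (l n)) (fun n => (H n).congr (W.scaled_coeFn (l n))) hu hh
  -- The limit multiplier is recovered as ρu₀; it lies in L²(Q_T) because ρ is bounded.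
  have mL : MemLp (fun p => W.ρ p * u₀ p) 2 P.μQ := (Lp.memLp u₀).mul W.memLp_ρ
  have eL : (fun p => (W.ρ p)⁻¹ * mL.toLp _ p) =ᵐ[P.μQ] u₀ := by
    filter_upwards [mL.coeFn_toLp, ae_restrict_mem P.isOpen_QT.measurableSet] with p hp hQ
    rw [hp, inv_mul_cancel_left₀ (W.isWeight_ρ.pos W.ρstar_pos hQ).ne']
  have HL : W.IsBackward (fun p => (W.ρ p)⁻¹ * mL.toLp _ p) z₀ G₀ h₀ := H₀.congr eL
  let l₀ : W.Lam := ⟨mL.toLp _, z₀, G₀, h₀, HL⟩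
  have e1 : W.wLstar l₀ = h₀ := by
    obtain ⟨z', G', H'⟩ := W.wLstar_spec l₀
    exact H'.unique HL
  have e2 : W.scaled l₀ = u₀ := Lp.ext ((W.scaled_coeFn l₀).trans eL)
  refine ⟨l₀, ?_⟩
  rw [tendsto_iff_norm_sub_tendsto_zero]
  have s1 := (tendsto_iff_norm_sub_tendsto_zero.1 hu).pow 2
  have s2 := (tendsto_iff_norm_sub_tendsto_zero.1 hh).pow 2
  have s3 := (s1.add s2).sqrt
  simp only [ne_eq, OfNat.ofNat_ne_zero, not_false_eq_true, zero_pow, add_zero,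
    Real.sqrt_zero] at s3
  refine s3.congr fun n => ?_
  rw [← Real.sqrt_sq (norm_nonneg (l n - l₀)), W.norm_sq_Lam, map_sub, map_sub, e1, e2]
  rfl

end Setting

/-! ### Coercive mixed problems -/

section Mixed

variable {V M : Type*} [NormedAddCommGroup V] [InnerProductSpace ℝ V] [CompleteSpace V]
  [NormedAddCommGroup M] [InnerProductSpace ℝ M] [CompleteSpace M]

/-- Subtracting the second equation from the first turns the saddle point system into one equation
for a nonsymmetric form whose diagonal is A(v, v) + C(m, m). Lax–Milgram then gives a bounded
inverse, and composing it with the Riesz map gives the solution operator. -/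
theorem mixedWellPosed_of_coercive (A : V →L[ℝ] V →L[ℝ] ℝ) (B : V →L[ℝ] M →L[ℝ] ℝ)
    (C : M →L[ℝ] M →L[ℝ] ℝ) {θ₁ θ₂ : ℝ} (hθ₁ : 0 < θ₁) (hθ₂ : 0 < θ₂)
    (hA : ∀ v, θ₁ * ‖v‖ ^ 2 ≤ A v v) (hC : ∀ m, θ₂ * ‖m‖ ^ 2 ≤ C m m) :
    MixedWellPosed (fun y y' => A y y') (fun y m => B y m) (fun m m' => C m m') := by
  let E := WithLp 2 (V × M)
  let e : E ≃L[ℝ] V × M := WithLp.prodContinuousLinearEquiv 2 ℝ V M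
  let p₁ : E →L[ℝ] V := (ContinuousLinearMap.fst ℝ V M).comp (e : E →L[ℝ] V × M)
  let p₂ : E →L[ℝ] M := (ContinuousLinearMap.snd ℝ V M).comp (e : E →L[ℝ] V × M)
  let F : E →L[ℝ] E →L[ℝ] ℝ :=
    A.bilinearComp p₁ p₁ + B.flip.bilinearComp p₂ p₁ - B.bilinearComp p₁ p₂ + C.bilinearComp p₂ p₂
  have hF : ∀ v w : E, F v w = A (p₁ v) (p₁ w) + B (p₁ w) (p₂ v) - B (p₁ v) (p₂ w) +
      C (p₂ v) (p₂ w) := fun v w => rfl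
  have coer : IsCoercive F := by
    refine ⟨min θ₁ θ₂, lt_min hθ₁ hθ₂, fun v => ?_⟩
    have hn : ‖v‖ * ‖v‖ = ‖p₁ v‖ ^ 2 + ‖p₂ v‖ ^ 2 := by
      rw [← sq]
      exact WithLp.prod_norm_sq_eq_of_L2 v
    have i1 := hA (p₁ v)
    have i2 := hC (p₂ v)
    rw [hF, mul_assoc, hn, mul_add]
    have j1 := mul_le_mul_of_nonneg_right (min_le_left θ₁ θ₂) (sq_nonneg ‖p₁ v‖)
    have j2 := mul_le_mul_of_nonneg_right (min_le_right θ₁ θ₂) (sq_nonneg ‖p₂ v‖)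
    linarith
  let Q : E ≃L[ℝ] E := coer.continuousLinearEquivOfBilin
  have hQ : ∀ v w, inner ℝ (Q v) w = F v w := coer.continuousLinearEquivOfBilin_apply
  let R : (E →L[ℝ] ℝ) →L[ℝ] E :=
    LinearMap.mkContinuous
      { toFun := (InnerProductSpace.toDual ℝ E).symm
        map_add' := map_add _
        map_smul' := fun a k => by simp } 1 fun k => by
      rw [one_mul]
      exact ((InnerProductSpace.toDual ℝ E).symm.norm_map k).le
  have hR : ∀ (k : E →L[ℝ] ℝ) (w : E), inner ℝ (R k) w = k w := fun k w =>
    InnerProductSpace.toDual_symm_apply (𝕜 := ℝ)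
  -- The minus sign in front of `g` matches the sign change of the second equation.
  let D : ((V →L[ℝ] ℝ) × (M →L[ℝ] ℝ)) →L[ℝ] (E →L[ℝ] ℝ) :=
    (((ContinuousLinearMap.compL ℝ E V ℝ).flip p₁).comp (ContinuousLinearMap.fst ℝ _ _)) -
      ((ContinuousLinearMap.compL ℝ E M ℝ).flip p₂).comp (ContinuousLinearMap.snd ℝ _ _)
  have hD : ∀ f g w, D (f, g) w = f (p₁ w) - g (p₂ w) := fun f g w => rfl
  refine ⟨(e : E →L[ℝ] V × M).comp ((Q.symm : E →L[ℝ] E).comp (R.comp D)), fun f g y m => ?_⟩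
  have s : (y, m) = ((e : E →L[ℝ] V × M).comp ((Q.symm : E →L[ℝ] E).comp (R.comp D))) (f, g) ↔
      Q (e.symm (y, m)) = R (D (f, g)) := by
    change (y, m) = e (Q.symm (R (D (f, g)))) ↔ _
    rw [← e.symm_apply_eq, Q.eq_symm_apply]
  have e1 : p₁ (e.symm (y, m)) = y := rfl
  have e2 : p₂ (e.symm (y, m)) = m := rfl
  rw [s]
  constructor
  · rintro ⟨h1, h2⟩
    refine ext_inner_right ℝ fun w => ?_
    rw [hQ, hR, hD, hF, e1, e2]
    have a1 := h1 (p₁ w)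
    have a2 := h2 (p₂ w)
    linarith
  · intro h
    have k : ∀ w, F (e.symm (y, m)) w = f (p₁ w) - g (p₂ w) := fun w => by
      rw [← hQ, h, hR, hD]
    simp only [hF, e1, e2] at k
    refine ⟨fun y' => ?_, fun m' => ?_⟩
    · have := k (e.symm (y', 0))
      have z1 : p₁ (e.symm (y', 0)) = y' := rfl
      have z2 : p₂ (e.symm (y', 0)) = 0 := rfl
      rw [z1, z2] at this
      simpa using this
    · have := k (e.symm (0, m'))
      have z1 : p₁ (e.symm (0, m')) = 0 := rfl
      have z2 : p₂ (e.symm (0, m')) = m' := rfl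
      rw [z1, z2] at this
      simp only [map_zero, zero_apply] at this
      linarith

end Mixed

/-- Young's inequality with weights θ₁ and θ₂ gives back exactly half of the left side, so no extra
constant appears. -/
lemma energy_le_of_le {θ₁ θ₂ x y K p q : ℝ} (hθ₁ : 0 < θ₁) (hθ₂ : 0 < θ₂)
    (h : θ₁ * x ^ 2 + θ₂ * y ^ 2 ≤ p * K * x + q * K * y) :
    θ₁ * x ^ 2 + θ₂ * y ^ 2 ≤ (p ^ 2 / θ₁ + q ^ 2 / θ₂) * K ^ 2 := by
  have a1 : 2 * (p * K * x) ≤ θ₁ * x ^ 2 + p ^ 2 / θ₁ * K ^ 2 := by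
    have : 0 ≤ θ₁ * (x - p * K / θ₁) ^ 2 := by positivity
    have e : θ₁ * (x - p * K / θ₁) ^ 2 =
        θ₁ * x ^ 2 + p ^ 2 / θ₁ * K ^ 2 - 2 * (p * K * x) := by
      field_simp
      ring
    linarith
  have a2 : 2 * (q * K * y) ≤ θ₂ * y ^ 2 + q ^ 2 / θ₂ * K ^ 2 := by
    have : 0 ≤ θ₂ * (y - q * K / θ₂) ^ 2 := by positivity
    have e : θ₂ * (y - q * K / θ₂) ^ 2 =
        θ₂ * y ^ 2 + q ^ 2 / θ₂ * K ^ 2 - 2 * (q * K * y) := by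
      field_simp
      ring
    linarith
  linarith

/-! ### Continuity and coercivity of the forms of the mixed problem. -/

namespace Setting

variable {P : Problem N} (W : Setting P)

lemma norm_sq_Y (y : W.Y) : ‖y‖ ^ 2 = ‖W.obs y‖ ^ 2 + W.η * ‖W.res y‖ ^ 2 := by
  induction y using UniformSpace.Completion.induction_on with
  | hp =>
    exact isClosed_eq (by fun_prop) (by fun_prop)
  | ih y =>
    rw [W.obs_coe, W.res_coe, UniformSpace.Completion.norm_coe, W.norm_sq_Y₀]

/-- Restriction from `Q_T` to `q_T`. -/
def restr : Lp ℝ 2 P.μQ →L[ℝ] Lp ℝ 2 W.μq :=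
  LinearMap.mkContinuous
    { toFun := fun f => ((Lp.memLp f).mono_measure W.μq_le).toLp f
      map_add' := fun f g => by
        rw [← MemLp.toLp_add]
        exact MemLp.toLp_congr _ _ (ae_mono W.μq_le (Lp.coeFn_add f g))
      map_smul' := fun a f => by
        rw [RingHom.id_apply, ← MemLp.toLp_const_smul]
        exact MemLp.toLp_congr _ _ (ae_mono W.μq_le (Lp.coeFn_smul a f)) } 1 fun f => by
    rw [one_mul]
    change ‖((Lp.memLp f).mono_measure W.μq_le).toLp f‖ ≤ ‖f‖
    rw [Lp.norm_toLp, Lp.norm_def]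
    exact ENNReal.toReal_mono (Lp.memLp f).2.ne (eLpNorm_mono_measure _ W.μq_le)

lemma norm_restr_le (f : Lp ℝ 2 P.μQ) : ‖W.restr f‖ ≤ ‖f‖ := by
  rw [← one_mul ‖f‖]
  exact W.restr.le_of_opNorm_le (LinearMap.mkContinuous_norm_le _ zero_le_one _) f

lemma restr_coeFn (f : Lp ℝ 2 P.μQ) : W.restr f =ᵐ[W.μq] f :=
  ((Lp.memLp f).mono_measure W.μq_le).coeFn_toLp

/-- The form b pairs ρ⁻¹Ly with λ itself, whereas the norm of `Λ` sees only ρ⁻¹λ; the boundedness of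
ρ bridges the gap and makes b continuous. -/
lemma exists_bound_fn : ∃ R, ∀ l : W.Lam, ‖l.fn‖ ≤ R * ‖l‖ := by
  have h := W.memLp_ρ.2
  rw [eLpNorm_exponent_top] at h
  refine ⟨(eLpNormEssSup W.ρ P.μQ).toReal, fun l => ?_⟩
  refine (Lp.norm_le_mul_norm_of_ae_le_mul ?_).trans
    (mul_le_mul_of_nonneg_left (W.norm_scaled_le l) ENNReal.toReal_nonneg)
  filter_upwards [ae_le_eLpNormEssSup (f := W.ρ) (μ := P.μQ), W.scaled_coeFn l,
    ae_restrict_mem P.isOpen_QT.measurableSet] with p h1 h2 hp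
  have e : l.fn p = W.ρ p * W.scaled l p := by
    rw [h2, mul_inv_cancel_left₀ (W.isWeight_ρ.pos W.ρstar_pos hp).ne']
  rw [e, norm_mul]
  refine mul_le_mul_of_nonneg_right ?_ (norm_nonneg _)
  rw [← toReal_enorm]
  exact ENNReal.toReal_mono h.ne h1

/-- `λ ↦ λ ∈ L²(Q_T)` as a continuous map. -/
def fnL : W.Lam →L[ℝ] Lp ℝ 2 P.μQ :=
  LinearMap.mkContinuousOfExistsBound
    { toFun := Lam.fn
      map_add' := fun _ _ => rfl
      map_smul' := fun _ _ => rfl } W.exists_bound_fn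

lemma memLp_weighted (yobs : Lp ℝ 2 W.μq) : MemLp (fun p => (W.ρ₀ p)⁻¹ * yobs p) 2 W.μq :=
  (Lp.memLp yobs).mul ((W.isWeight_ρ₀.memLp_inv W.ρstar_pos).mono_measure W.μq_le)

lemma real_inner_Lp {X : Type*} [MeasurableSpace X] {μ : Measure X} (f g : Lp ℝ 2 μ) :
    inner ℝ f g = ∫ x, f x * g x ∂μ := by
  rw [L2.inner_def]
  exact integral_congr_ae (ae_of_all _ fun x => by simp [mul_comm])

lemma ae_μq_mem : ∀ᵐ p ∂W.μq, p ∈ P.QT :=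
  ae_mono W.μq_le (ae_restrict_mem P.isOpen_QT.measurableSet)

lemma a_eq (α r : ℝ) (y y' : W.Y) : W.a α r y y' =
    (1 - α) * inner ℝ (W.obs y) (W.obs y') + r * inner ℝ (W.res y) (W.res y') := by
  rw [real_inner_Lp, real_inner_Lp]
  rfl

/-- The factor ρ₀ that recovers y from ρ₀⁻¹y cancels against the one hidden in L⋆(ρ⁻¹λ), so b is
continuous even where ρ₀ is unbounded. -/
lemma b_eq (α : ℝ) (y : W.Y) (l : W.Lam) : W.b α y l =
    inner ℝ (W.res y) (W.fnL l) - α * inner ℝ (W.obs y) (W.restr (W.wLstarL l)) := by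
  rw [real_inner_Lp, real_inner_Lp, b]
  congr 2
  refine integral_congr_ae ?_
  filter_upwards [W.restr_coeFn (W.wLstarL l), W.ae_μq_mem] with p h1 hp
  have h0 := (W.isWeight_ρ₀.pos W.ρstar_pos hp).ne'
  rw [h1]
  change (W.ρ₀ p)⁻¹ * W.wLstar l p * (W.ρ₀ p * W.obs y p) = W.obs y p * W.wLstar l p
  field_simp

lemma c_eq (α : ℝ) (l l' : W.Lam) :
    W.c α l l' = α * inner ℝ (W.wLstarL l) (W.wLstarL l') := by
  rw [real_inner_Lp, c]
  congr 1
  refine integral_congr_ae ?_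
  filter_upwards [ae_restrict_mem P.isOpen_QT.measurableSet] with p hp
  have h0 := (W.isWeight_ρ₀.pos W.ρstar_pos hp).ne'
  change (W.ρ₀ p) ^ 2 * ((W.ρ₀ p)⁻¹ * W.wLstar l p) * ((W.ρ₀ p)⁻¹ * W.wLstar l' p) =
    W.wLstar l p * W.wLstar l' p
  field_simp

lemma l₁_eq (α : ℝ) (yobs : Lp ℝ 2 W.μq) (y : W.Y) : W.l₁ α yobs y =
    (1 - α) * inner ℝ ((W.memLp_weighted yobs).toLp _) (W.obs y) := by
  rw [real_inner_Lp, l₁]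
  congr 1
  refine integral_congr_ae ?_
  filter_upwards [(W.memLp_weighted yobs).coeFn_toLp] with p hp
  rw [hp]

lemma l₂_eq (α : ℝ) (yobs : Lp ℝ 2 W.μq) (l : W.Lam) : W.l₂ α yobs l =
    -α * inner ℝ ((W.memLp_weighted yobs).toLp _) (W.restr (W.wLstarL l)) := by
  rw [real_inner_Lp, l₂]
  congr 1
  refine integral_congr_ae ?_
  filter_upwards [(W.memLp_weighted yobs).coeFn_toLp, W.restr_coeFn (W.wLstarL l)] with p hp h1
  rw [hp, h1]
  change yobs p * ((W.ρ₀ p)⁻¹ * W.wLstar l p) = (W.ρ₀ p)⁻¹ * yobs p * W.wLstar l p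
  ring

lemma le_a {α r θ : ℝ} (h : θ = min (1 - α) (r / W.η)) (y : W.Y) :
    θ * ‖y‖ ^ 2 ≤ W.a α r y y := by
  rw [a_eq, W.norm_sq_Y, real_inner_self_eq_norm_sq, real_inner_self_eq_norm_sq, mul_add]
  have h1 : θ ≤ 1 - α := h ▸ min_le_left _ _
  have h2 : θ * W.η ≤ r := (le_div_iff₀ W.η_pos).1 (h ▸ min_le_right _ _)
  have j1 := mul_le_mul_of_nonneg_right h1 (sq_nonneg ‖W.obs y‖)
  have j2 := mul_le_mul_of_nonneg_right h2 (sq_nonneg ‖W.res y‖)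
  linarith

/-- Since ρ₀ ≥ ρ_⋆, the energy inequality gives ‖ρ⁻¹λ‖² ≤ (C²/ρ_⋆²) ‖ρ₀L⋆(ρ⁻¹λ)‖². Hence the squared
norm of λ is at most (1 + C²/ρ_⋆²) times the second term, and θ₂ is α divided by this factor. -/
lemma le_c {C α θ : ℝ} (hα : 0 ≤ α) (h : W.IsEnergyConstant C)
    (hθ : θ = α * W.ρstar ^ 2 / (W.ρstar ^ 2 + C ^ 2)) (l : W.Lam) :
    θ * ‖l‖ ^ 2 ≤ W.c α l l := by
  have hρ := W.ρstar_pos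
  rw [c_eq, real_inner_self_eq_norm_sq, W.norm_sq_Lam]
  change _ ≤ α * ‖W.wLstar l‖ ^ 2
  have h1 : ‖W.scaled l‖ ^ 2 = ∫ p in P.QT, ((W.ρ p)⁻¹ * l.fn p) ^ 2 := by
    rw [norm_Lp_sq]
    refine integral_congr_ae ?_
    filter_upwards [W.scaled_coeFn l] with p hp
    rw [hp, Real.norm_eq_abs, sq_abs]
  have h2 : ∫ p in P.QT, (W.Lstar l p) ^ 2 ≤ (W.ρstar ^ 2)⁻¹ * ‖W.wLstar l‖ ^ 2 :=
    W.integral_source_sq_le (W.wLstar l)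
  have h3 : ‖W.scaled l‖ ^ 2 ≤ C ^ 2 * ((W.ρstar ^ 2)⁻¹ * ‖W.wLstar l‖ ^ 2) := by
    have n1 : 0 ≤ ∫ p in P.QT, ((W.ρ p)⁻¹ * l.fn p) ^ 2 := integral_nonneg fun p => sq_nonneg _
    have n2 : 0 ≤ ∫ p in P.QT, (W.Lstar l p) ^ 2 := integral_nonneg fun p => sq_nonneg _
    have h4 := pow_le_pow_left₀ (Real.sqrt_nonneg _) (h l) 2
    rw [mul_pow, Real.sq_sqrt n1, Real.sq_sqrt n2] at h4
    rw [h1]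
    exact h4.trans (mul_le_mul_of_nonneg_left h2 (sq_nonneg C))
  have hpos : 0 < W.ρstar ^ 2 + C ^ 2 := by positivity
  rw [hθ, div_mul_eq_mul_div, div_le_iff₀ hpos]
  have h5 : W.ρstar ^ 2 * ‖W.scaled l‖ ^ 2 ≤ C ^ 2 * ‖W.wLstar l‖ ^ 2 := by
    have := mul_le_mul_of_nonneg_left h3 (sq_nonneg W.ρstar)
    refine this.trans_eq ?_
    field_simp
  have := mul_le_mul_of_nonneg_left h5 hα
  linarith

lemma mixedWellPosed {α r : ℝ} (hα : 0 < α) (hα' : α < 1) (hr : 0 < r) :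
    MixedWellPosed (W.a α r) (W.b α) (W.c α) := by
  obtain ⟨C, hC, h⟩ := exists_isEnergyConstant P
  have hρ := W.ρstar_pos
  let I (μ : Measure (Pt N)) : Lp ℝ 2 μ →L[ℝ] Lp ℝ 2 μ →L[ℝ] ℝ := innerSL ℝ
  have key := mixedWellPosed_of_coercive
    ((1 - α) • (I W.μq).bilinearComp W.obs W.obs + r • (I P.μQ).bilinearComp W.res W.res)
    ((I P.μQ).bilinearComp W.res W.fnL -
      α • (I W.μq).bilinearComp W.obs (W.restr.comp W.wLstarL))
    (α • (I P.μQ).bilinearComp W.wLstarL W.wLstarL)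
    (θ₁ := min (1 - α) (r / W.η)) (θ₂ := α * W.ρstar ^ 2 / (W.ρstar ^ 2 + C ^ 2))
    (lt_min (by linarith) (div_pos hr W.η_pos)) (by positivity)
    (fun y => (W.le_a rfl y).trans_eq (W.a_eq α r y y))
    (fun l => (W.le_c hα.le (h W) rfl l).trans_eq (W.c_eq α l l))
  convert! key using 1
  · funext y y'
    exact W.a_eq α r y y'
  · funext y l
    exact W.b_eq α y l
  · funext l l'
    exact W.c_eq α l l'

lemma existsUnique_solution {α r : ℝ} (h : MixedWellPosed (W.a α r) (W.b α) (W.c α))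
    (yobs : Lp ℝ 2 W.μq) : ∃! s : W.Y × W.Lam,
      IsMixedSolution (W.a α r) (W.b α) (W.c α) (W.l₁ α yobs) (W.l₂ α yobs) s.1 s.2 := by
  obtain ⟨S, hS⟩ := h
  let k := (W.memLp_weighted yobs).toLp _
  let f : W.Y →L[ℝ] ℝ := (1 - α) • (innerSL ℝ k).comp W.obs
  let g : W.Lam →L[ℝ] ℝ := (-α) • (innerSL ℝ k).comp (W.restr.comp W.wLstarL)
  have hf : W.l₁ α yobs = f := funext fun y => W.l₁_eq α yobs y
  have hg : W.l₂ α yobs = g := funext fun l => W.l₂_eq α yobs l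
  rw [hf, hg]
  exact ⟨S (f, g), (hS f g _ _).2 rfl, fun s hs => (hS f g _ _).1 hs⟩

/-- Testing with (y, λ) and subtracting the two equations cancels b, leaving a(y, y) + c(λ, λ) =
l₁(y) - l₂(λ). Cauchy–Schwarz bounds the right side by (1 - α)K‖y‖ + αK‖λ‖ with K = ‖ρ₀⁻¹y_obs‖. -/
lemma solution_estimate {α r θ₁ θ₂ : ℝ} (hα : 0 < α) (hα' : α < 1) (hθ₁ : 0 < θ₁)
    (hθ₂ : 0 < θ₂) (ha : ∀ y : W.Y, θ₁ * ‖y‖ ^ 2 ≤ W.a α r y y)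
    (hc : ∀ l : W.Lam, θ₂ * ‖l‖ ^ 2 ≤ W.c α l l) (yobs : Lp ℝ 2 W.μq) (y : W.Y) (l : W.Lam)
    (h : IsMixedSolution (W.a α r) (W.b α) (W.c α) (W.l₁ α yobs) (W.l₂ α yobs) y l) :
    θ₁ * ‖y‖ ^ 2 + θ₂ * ‖l‖ ^ 2 ≤
      ((1 - α) ^ 2 / θ₁ + α ^ 2 / θ₂) * ∫ p in W.qT, ((W.ρ₀ p)⁻¹ * yobs p) ^ 2 := by
  set k := (W.memLp_weighted yobs).toLp _
  have hk : ∫ p in W.qT, ((W.ρ₀ p)⁻¹ * yobs p) ^ 2 = ‖k‖ ^ 2 := by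
    rw [norm_toLp_sq]
    simp only [Real.norm_eq_abs, sq_abs]
  rw [hk]
  refine energy_le_of_le hθ₁ hθ₂ ?_
  have e1 := h.1 y
  have e2 := h.2 l
  rw [l₁_eq] at e1
  rw [l₂_eq] at e2
  have n1 : ‖W.obs y‖ ≤ ‖y‖ := by
    refine le_of_sq_le_sq ?_ (norm_nonneg _)
    rw [W.norm_sq_Y]
    exact le_add_of_nonneg_right (mul_nonneg W.η_pos.le (sq_nonneg _))
  have n2 : ‖W.restr (W.wLstarL l)‖ ≤ ‖l‖ := (W.norm_restr_le _).trans (W.norm_wLstar_le l)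
  have i1 : inner ℝ k (W.obs y) ≤ ‖k‖ * ‖y‖ :=
    (real_inner_le_norm _ _).trans (mul_le_mul_of_nonneg_left n1 (norm_nonneg _))
  have i2 : inner ℝ k (W.restr (W.wLstarL l)) ≤ ‖k‖ * ‖l‖ :=
    (real_inner_le_norm _ _).trans (mul_le_mul_of_nonneg_left n2 (norm_nonneg _))
  have m1 := mul_le_mul_of_nonneg_left i1 (sub_nonneg.2 hα'.le)
  have m2 := mul_le_mul_of_nonneg_left i2 hα.le
  linarith [ha y, hc l]

end Setting

end ParabolicInverse

end

theorem mainTheorem7 {N : ℕ} (hN : 0 < N) (P : ParabolicInverse.Problem N) :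
    (∃ C > 0, ∀ W : ParabolicInverse.Setting P, W.IsEnergyConstant C) ∧
    ∀ (W : ParabolicInverse.Setting P) (α r : ℝ), 0 < α → α < 1 → 0 < r →
      ParabolicInverse.MixedWellPosed (W.a α r) (W.b α) (W.c α) ∧
      (∀ yobs : Lp ℝ 2 W.μq, ∃! s : W.Y × W.Lam,
        ParabolicInverse.IsMixedSolution (W.a α r) (W.b α) (W.c α)
          (W.l₁ α yobs) (W.l₂ α yobs) s.1 s.2) ∧
      ∀ C : ℝ, 0 ≤ C → W.IsEnergyConstant C →
        ∀ θ₁ θ₂ : ℝ, θ₁ = min (1 - α) (r / W.η) →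
          θ₂ = α * W.ρstar ^ 2 / (W.ρstar ^ 2 + C ^ 2) →
          (∀ y : W.Y, θ₁ * ‖y‖ ^ 2 ≤ W.a α r y y) ∧
          (∀ l : W.Lam, θ₂ * ‖l‖ ^ 2 ≤ W.c α l l) ∧
          ∀ (yobs : Lp ℝ 2 W.μq) (y : W.Y) (l : W.Lam),
            ParabolicInverse.IsMixedSolution (W.a α r) (W.b α) (W.c α)
              (W.l₁ α yobs) (W.l₂ α yobs) y l →
            θ₁ * ‖y‖ ^ 2 + θ₂ * ‖l‖ ^ 2 ≤
              ((1 - α) ^ 2 / θ₁ + α ^ 2 / θ₂) * ∫ p in W.qT, ((W.ρ₀ p)⁻¹ * yobs p) ^ 2 := by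
  refine ⟨ParabolicInverse.Setting.exists_isEnergyConstant P, fun W α r hα hα' hr => ?_⟩
  have hw := W.mixedWellPosed hα hα' hr
  refine ⟨hw, W.existsUnique_solution hw, fun C _ hC θ₁ θ₂ h₁ h₂ => ?_⟩
  have hρ := W.ρstar_pos
  have hθ₁ : 0 < θ₁ := h₁ ▸ lt_min (by linarith) (div_pos hr W.η_pos)
  have hθ₂ : 0 < θ₂ := by
    rw [h₂]
    positivity
  have ha := W.le_a h₁
  have hc := W.le_c hα.le hC h₂
  exact ⟨ha, hc, fun yobs y l h => W.solution_estimate hα hα' hθ₁ hθ₂ ha hc yobs y l h⟩
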